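/- Let $\varepsilon_1,\dots,\varepsilon_5$ be the standard basis of $\mathbb Z^5$ and put $$a_1=2\varepsilon_1-\varepsilon_2,\quad a_2=-\varepsilon_1+2\varepsilon_2-\varepsilon_5,\quad a_3=-\varepsilon_1-\varepsilon_2+\varepsilon_5,\quad c_1=2\varepsilon_4-\varepsilon_5,\quad c_2=-\varepsilon_4+\varepsilon_5,\quad c_3=-\varepsilon_4,$$ $e=-\varepsilon_3$, $f=\varepsilon_3$, $b_i=a_i+e$, $d_l=c_l+f$. Let $\bar\nabla^*\subset\mathbb R^5$ be the convex hull of $\bar\Delta_1\cup\bar\Delta_2$, where $\bar\Delta_1=\operatorname{conv}\{0,a_i,b_i\}$ and $\bar\Delta_2=\operatorname{conv}\{0,c_l,d_l\}$ ($i,l=1,2,3$). Its lattice points are $0$ and the $14$ points $a_i,b_i,c_l,d_l,e,f$. A *fine star triangulation* of $\bar\nabla^*$ is a triangulation whose vertex set is the set of all lattice points of $\bar\nabla^*$ and all of whose maximal simplices contain $0$; it is *coherent* (regular) if it is induced by a height function on the lattice points. Let $G_2^*\cong\mathbb Z_3$ be generated by the linear map $g_2^*$ with $a_i\mapsto a_{i+1}$,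 $b_i\mapsto b_{i+1}$, $c_l\mapsto c_{l+1}$, $d_l\mapsto d_{l+1}$ (indices mod 3), $e\mapsto e$, $f\mapsto f$. The relation $a_i+c_l=b_i+d_l$ is a mixed circuit. A triangulation has sign $+$ at $(l,i)$ if it contains the simplices $\{b_i,c_l,d_l\}$ and $\{a_i,b_i,d_l\}$, and sign $-$ if it contains $\{a_i,c_l,d_l\}$ and $\{a_i,b_i,c_l\}$. Its type is the resulting $3\times 3$ array of signs. For a fine star triangulation $T$ let $\mathbb P_T$ be the toric variety, with respect to the lattice $\mathbb Z^5$, of the fan of cones over the simplices of $T$: in homogeneous coordinates $z_\rho$, indexed by the $14$ nonzero lattice points $\rho$, it is the set of $z\in\mathbb C^{14}$ such that the $\rho$ with $z_\rho=0$ lie in a common simplex of $T$, modulo the group of all $t\in(\mathbb C^\times)^{14}$ with $\prod_\rho t_\rho^{\langle m,\rho\rangle}=1$ for all $m\in\mathbb Z^5$. Call $\mathbb P_T$ projective if its fan has a strictly convex piecewise linear support function. Write $D_\rho$ for the divisor $z_\rho=0$ and for its class in the intersection ring $\mathbb Q[D_\rho]/(I_{SR}(T)+\langle\sum_\rho\langle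 m,\rho\rangle D_\rho : m\in\mathbb Z^5\rangle)$, and let $\bar D^*_{0,1}=\sum_i(D_{a_i}+D_{b_i})+D_e$, $\bar D^*_{0,2}=\sum_l(D_{c_l}+D_{d_l})+D_f$. For complex coefficients $\alpha_i,\alpha',\alpha'',\beta_l,\beta',\beta''$ let $\bar X^*=\bar X^*_T\subset\mathbb P_T$ be given by $F_1=F_2=0$, where $$F_1=\Big(\sum_i\alpha_i z_{a_i}^3z_{b_i}^3\Big)z_e+\big(\alpha' z_{d_1}z_{d_2}z_{d_3}z_f+\alpha'' z_{b_1}z_{b_2}z_{b_3}z_e\big)z_{a_1}z_{a_2}z_{a_3},$$ $$F_2=\Big(\sum_l\beta_l z_{c_l}^3z_{d_l}^3\Big)z_f+\big(\beta' z_{b_1}z_{b_2}z_{b_3}z_e+\beta'' z_{d_1}z_{d_2}z_{d_3}z_f\big)z_{c_1}z_{c_2}z_{c_3}.$$ Then: 1. $\bar\nabla^*$ has exactly $824$ fine star triangulations, and exactly $720$ of them are coherent. 2. They are distributed over the types as follows. For each of the seven types below (arrays read row by row) and for its negative, the orbit under row permutations, column permutations and transposition has $\mu$ elements, and each type in the orbit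 is the type of exactly $n$ fine star triangulations, exactly $k$ of them coherent: | type | $\mu$ | $n$ | $k$ | |---|---|---|---| | $+++\,/\,+++\,/\,+++$ | 1 | $2^6$ | 36 | | $-++\,/\,+++\,/\,+++$ | 9 | $2^2$ | 4 | | $--+\,/\,+++\,/\,+++$ | 18 | $2^2$ | 4 | | $---\,/\,+++\,/\,+++$ | 6 | $2^4$ | 12 | | $--+\,/\,-++\,/\,+++$ | 36 | $2^0$ | 1 | | $---\,/\,-++\,/\,+++$ | 36 | $2^1$ | 2 | | $--+\,/\,--+\,/\,+++$ | 9 | $2^2$ | 4 | (so $824=2(64+36+72+96+36+72+36)$ and $720=2(36+36+72+72+36+72+36)$). 3. Exactly $8$ fine star triangulations are invariant under $G_2^*$. None of them is coherent, and for none of them is $\mathbb P_T$ projective: there is no projective $G_2^*$-symmetric toric resolution (given by a fine star triangulation) of the ambient space. 4. The exceptional sets coming from the pure circuits $a_i+b_j=a_j+b_i$ and $c_l+d_m=c_m+d_l$ do not meet $\bar X^*$: for every fine star triangulation $T$ and all $i\ne j$, $D_{a_i}D_{b_j}\bar D^*_{0,1}=0$ and $D_{c_i}D_{d_j}\bar D^*_{0,2}=0$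 in the intersection ring; and if all $\alpha_i$ and all $\beta_l$ are nonzero, then $D_{a_i}\cap D_{b_j}\cap\bar X^*=\emptyset$ and $D_{c_i}\cap D_{d_j}\cap\bar X^*=\emptyset$ in $\mathbb P_T$. 5. Let $T_+$ (respectively $T_-$) be the class of coherent fine star triangulations all of whose signs are $+$ (respectively $-$). Each class has exactly $36$ elements, and for each $T$ in $T_+$ or $T_-$ and $G_2^*$-invariant equations ($\alpha_1=\alpha_2=\alpha_3\neq0$, $\beta_1=\beta_2=\beta_3\ne0$) $\bar X^*_T$ is $G_2^*$-symmetric: although $T$ is not invariant, the cyclic permutation $z\mapsto w$, $w_{g_2^*\rho}=z_\rho$, of the homogeneous coordinates is defined at every point of $\bar X^*_T$ and induces a bijection of $\bar X^*_T$ onto itself whose third power is the identity. -/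

import Mathlib

namespace NablaBar

noncomputable section

/-! ### The polytope -/

/-- Labels of the nonzero lattice points of the polytope; the indices `1, 2, 3` are `0, 1, 2`. -/
inductive Ray : Type
  | a (i : Fin 3)
  | b (i : Fin 3)
  | c (l : Fin 3)
  | d (l : Fin 3)
  | e
  | f
  deriving DecidableEq, Fintype

open Ray

/-- The points in the lattice `ℤ⁵`: `a₁, a₂, a₃, b₁, …, d₃` are the twelve vertices
`ν̄₁, …, ν̄₁₂`, and `e = ν̄₁₃`, `f = ν̄₁₄`. -/
def nu : Ray → Fin 5 → ℤ
  | a i => (![![2, -1, 0, 0, 0], ![-1, 2, 0, 0, -1], ![-1, -1, 0, 0, 1]] : Fin 3 → Fin 5 → ℤ) i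
  | b i => (![![2, -1, -1, 0, 0], ![-1, 2, -1, 0, -1], ![-1, -1, -1, 0, 1]] :
      Fin 3 → Fin 5 → ℤ) i
  | c l => (![![0, 0, 0, 2, -1], ![0, 0, 0, -1, 1], ![0, 0, 0, -1, 0]] : Fin 3 → Fin 5 → ℤ) l
  | d l => (![![0, 0, 1, 2, -1], ![0, 0, 1, -1, 1], ![0, 0, 1, -1, 0]] : Fin 3 → Fin 5 → ℤ) l
  | e => ![0, 0, -1, 0, 0]
  | f => ![0, 0, 1, 0, 0]

/-- The ambient real vector space of the polytope. -/
abbrev E : Type := Fin 5 → ℝ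

/-- The lattice points above as points of `ℝ⁵`. -/
def pt (ρ : Ray) : E := fun k => (nu ρ k : ℝ)

/-- First polytope of the nef partition: the convex hull of `0, a_i, b_i`. -/
def deltaBar1 : Set E :=
  convexHull ℝ ({0} ∪ Set.range (fun i => pt (a i)) ∪ Set.range (fun i => pt (b i)))

/-- Second polytope of the nef partition: the convex hull of `0, c_l, d_l`. -/
def deltaBar2 : Set E :=
  convexHull ℝ ({0} ∪ Set.range (fun l => pt (c l)) ∪ Set.range (fun l => pt (d l)))

/-- The polytope `∇̄*`. -/
def polytope : Set E := convexHull ℝ (deltaBar1 ∪ deltaBar2)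

/-- The lattice points of `∇̄*`. -/
def latticePoints : Set E := {x ∈ polytope | ∃ n : Fin 5 → ℤ, x = fun k => (n k : ℝ)}

/-! ### Triangulations -/

/-- A fine star triangulation of `∇̄*`: the simplices cover the polytope, the vertices are
all its lattice points, and every maximal simplex contains the origin. -/
structure IsFineStar (K : Geometry.SimplicialComplex ℝ E) : Prop where
  space_eq : K.space = polytope
  vertices_eq : K.vertices = latticePoints
  star : ∀ s ∈ K.facets, (0 : E) ∈ s

/-- Coherent (regular) triangulations of the lattice points: the triangulation is the projection
of the lower faces of the convex hull of the points lifted by a height function `h`. -/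
def IsCoherent (K : Geometry.SimplicialComplex ℝ E) : Prop :=
  ∃ h : E → ℝ, ∀ s ∈ K.facets, ∃ φ : E →ᵃ[ℝ] ℝ,
    (∀ v ∈ s, φ v = h v) ∧ ∀ p ∈ latticePoints, p ∉ s → φ p < h p

/-- The fan of the cones over the simplices of a star triangulation carries a strictly convex
support function `ψ`, i.e. the associated complete toric variety is projective: `ψ` agrees with
a linear function exactly on each maximal cone, and lies above it elsewhere. -/
def IsProjectiveFan (K : Geometry.SimplicialComplex ℝ E) : Prop :=
  ∃ ψ : E → ℝ, ∀ s ∈ K.facets, ∃ m : E →ₗ[ℝ] ℝ, ∀ x : E,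
    m x ≤ ψ x ∧ (m x = ψ x ↔ x ∈ Submodule.span NNReal (s : Set E))

/-- The cyclic permutation of the labels generating `G₂*`. -/
def cyc : Ray → Ray
  | a i => a (i + 1)
  | b i => b (i + 1)
  | c l => c (l + 1)
  | d l => d (l + 1)
  | e => e
  | f => f

/-- The integer matrix of the generator of `G₂*`. -/
def g2Matrix : Matrix (Fin 5) (Fin 5) ℤ :=
  !![-1, -1, 0, 0, 0;
     1, 0, 0, 0, 0;
     0, 0, 1, 0, 0;
     -1, -2, 0, -2, -3;
     0, 1, 0, 1, 1]

/-- The generator of `G₂*` as a linear map on the space of the polytope. -/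
def g2 : E →ₗ[ℝ] E := Matrix.toLin' (g2Matrix.map (Int.cast : ℤ → ℝ))

theorem g2Matrix_nu : ∀ ρ k, ∑ j, g2Matrix k j * nu ρ j = nu (cyc ρ) k := by
  decide

/-- `g2` is the linear map which permutes the lattice points by `cyc`. -/
theorem g2_pt (ρ : Ray) : g2 (pt ρ) = pt (cyc ρ) := by
  ext k
  simp only [g2, pt, Matrix.toLin'_apply, Matrix.mulVec, dotProduct, Matrix.map_apply]
  exact_mod_cast g2Matrix_nu ρ k

/-- `K` is invariant under `G₂*`. -/
def IsSymmetric (K : Geometry.SimplicialComplex ℝ E) : Prop :=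
  ∀ s ∈ K.faces, ∃ t ∈ K.faces, (t : Set E) = g2 '' (s : Set E)

/-- The points labelled by `I` lie in a common simplex of `K`; for nonempty `I` this means that
they span a simplex of `K`. For a star triangulation it says that the rays labelled by `I` lie in
a common cone of the fan. -/
def Together (K : Geometry.SimplicialComplex ℝ E) (I : Set Ray) : Prop :=
  ∃ s ∈ K.faces, ∀ ρ ∈ I, pt ρ ∈ s

/-- The circuit `⟨a_i c_l | b_i d_l⟩` is triangulated by dropping `a_i` and by dropping `c_l`. -/
def CircuitPos (K : Geometry.SimplicialComplex ℝ E) (l i : Fin 3) : Prop :=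
  Together K {b i, c l, d l} ∧ Together K {a i, b i, d l}

/-- The circuit `⟨a_i c_l | b_i d_l⟩` is triangulated by dropping `b_i` and by dropping `d_l`. -/
def CircuitNeg (K : Geometry.SimplicialComplex ℝ E) (l i : Fin 3) : Prop :=
  Together K {a i, c l, d l} ∧ Together K {a i, b i, c l}

/-- Sign types; `true` is `+`, rows are indexed by `l` and columns by `i`. -/
abbrev SignPattern : Type := Matrix (Fin 3) (Fin 3) Bool

/-- `K` induces on the nine mixed circuits the triangulations given by the signs. -/
def HasType (K : Geometry.SimplicialComplex ℝ E) (σ : SignPattern) : Prop :=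
  ∀ l i, (σ l i = true → CircuitPos K l i) ∧ (σ l i = false → CircuitNeg K l i)

/-- The orbit of a sign type under row permutations, column permutations and transposition. -/
def typeOrbit (σ : SignPattern) : Set SignPattern :=
  {τ | ∃ r q : Equiv.Perm (Fin 3), τ = σ.submatrix r q ∨ τ = σ.transpose.submatrix r q}

/-- The table of star triangulations: a sign type, the size of its orbit, the number of fine star
triangulations of that type, and the number of coherent ones among them. -/
def typeTable : List (SignPattern × ℕ × ℕ × ℕ) :=
  [(!![true, true, true; true, true, true; true, true, true], 1, 2 ^ 6, 36),
   (!![false, true, true; true, true, true; true, true, true], 9, 2 ^ 2, 4),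
   (!![false, false, true; true, true, true; true, true, true], 18, 2 ^ 2, 4),
   (!![false, false, false; true, true, true; true, true, true], 6, 2 ^ 4, 12),
   (!![false, false, true; false, true, true; true, true, true], 36, 2 ^ 0, 1),
   (!![false, false, false; false, true, true; true, true, true], 36, 2 ^ 1, 2),
   (!![false, false, true; false, false, true; true, true, true], 9, 2 ^ 2, 4)]

/-- The classes `T₊` (for `true`) and `T₋` (for `false`): coherent fine star triangulations all of
whose mixed circuits have the same sign. -/
def TClass (sgn : Bool) : Set (Geometry.SimplicialComplex ℝ E) :=
  {K | IsFineStar K ∧ IsCoherent K ∧ HasType K (fun _ _ => sgn)}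

/-! ### The intersection ring of the toric variety -/

/-- The Stanley-Reisner ideal. -/
def stanleyReisner (K : Geometry.SimplicialComplex ℝ E) : Ideal (MvPolynomial Ray ℚ) :=
  Ideal.span {p | ∃ I : Finset Ray, ¬ Together K (I : Set Ray) ∧
    p = ∏ ρ ∈ I, MvPolynomial.X ρ}

/-- The ideal of linear equivalences `∑ ⟨m, ν_ρ⟩ D_ρ`. -/
def linearEquivalences : Ideal (MvPolynomial Ray ℚ) :=
  Ideal.span (Set.range fun m : Fin 5 → ℤ =>
    ∑ ρ : Ray, MvPolynomial.C ((∑ k, m k * nu ρ k : ℤ) : ℚ) * MvPolynomial.X ρ)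

/-- The rational intersection ring. -/
abbrev IntersectionRing (K : Geometry.SimplicialComplex ℝ E) : Type :=
  MvPolynomial Ray ℚ ⧸ (stanleyReisner K ⊔ linearEquivalences)

/-- The class of the toric divisor of a ray. -/
def divisorClass (K : Geometry.SimplicialComplex ℝ E) (ρ : Ray) : IntersectionRing K :=
  Ideal.Quotient.mk _ (MvPolynomial.X ρ)

/-- The class of `D̄*_{0,1} = ∑ (a_i + b_i) + e`. -/
def nefClass1 (K : Geometry.SimplicialComplex ℝ E) : IntersectionRing K :=
  ∑ i, (divisorClass K (a i) + divisorClass K (b i)) + divisorClass K e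

/-- The class of `D̄*_{0,2} = ∑ (c_l + d_l) + f`. -/
def nefClass2 (K : Geometry.SimplicialComplex ℝ E) : IntersectionRing K :=
  ∑ l, (divisorClass K (c l) + divisorClass K (d l)) + divisorClass K f

/-! ### The toric variety in homogeneous coordinates, and the complete intersection -/

/-- Points of `ℂ^14` outside the exceptional set: the rays of the vanishing coordinates lie in a
common cone. -/
def coxDomain (K : Geometry.SimplicialComplex ℝ E) : Set (Ray → ℂ) :=
  {z | Together K {ρ | z ρ = 0}}

/-- The group by which the homogeneous coordinates are divided. -/
def coxGroup : Subgroup (Ray → ℂˣ) where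
  carrier := {t | ∀ m : Fin 5 → ℤ, ∏ ρ, t ρ ^ (∑ k, m k * nu ρ k) = 1}
  one_mem' := by intro m; simp
  mul_mem' := by
    intro s t hs ht m
    simp only [Pi.mul_apply, mul_zpow, Finset.prod_mul_distrib]
    rw [hs m, ht m, one_mul]
  inv_mem' := by
    intro t ht m
    simp only [Pi.inv_apply, inv_zpow, Finset.prod_inv_distrib]
    rw [ht m, inv_one]

/-- Homogeneous coordinates of the same point. -/
def coxSetoid (K : Geometry.SimplicialComplex ℝ E) : Setoid (coxDomain K) where
  r z w := ∃ t ∈ coxGroup, ∀ ρ, w.1 ρ = (t ρ : ℂ) * z.1 ρ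
  iseqv :=
    { refl := fun z => ⟨1, coxGroup.one_mem, fun ρ => by simp⟩
      symm := by
        rintro z w ⟨t, ht, h⟩
        exact ⟨t⁻¹, coxGroup.inv_mem ht, fun ρ => by simp [h ρ]⟩
      trans := by
        rintro z w u ⟨t, ht, h⟩ ⟨t', ht', h'⟩
        exact ⟨t' * t, coxGroup.mul_mem ht' ht, fun ρ => by simp [h ρ, h' ρ, mul_assoc]⟩ }

/-- The (complex points of the) toric variety of a star triangulation. -/
def ToricVariety (K : Geometry.SimplicialComplex ℝ E) : Type := Quotient (coxSetoid K)

/-- The point with given homogeneous coordinates. -/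
def toPoint (K : Geometry.SimplicialComplex ℝ E) (z : coxDomain K) : ToricVariety K :=
  Quotient.mk (coxSetoid K) z

/-- The toric divisor of a ray. -/
def toricDivisor (K : Geometry.SimplicialComplex ℝ E) (ρ : Ray) : Set (ToricVariety K) :=
  {x | ∃ z, toPoint K z = x ∧ z.1 ρ = 0}

/-- The sections of the first nef divisor in homogeneous coordinates. -/
def F1 (α : Fin 3 → ℂ) (α' α'' : ℂ) (z : Ray → ℂ) : ℂ :=
  (∑ i, α i * z (a i) ^ 3 * z (b i) ^ 3) * z e +
    (α' * (z (d 0) * z (d 1) * z (d 2) * z f) + α'' * (z (b 0) * z (b 1) * z (b 2) * z e)) *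
      (z (a 0) * z (a 1) * z (a 2))

/-- The sections of the second nef divisor in homogeneous coordinates. -/
def F2 (β : Fin 3 → ℂ) (β' β'' : ℂ) (z : Ray → ℂ) : ℂ :=
  (∑ l, β l * z (c l) ^ 3 * z (d l) ^ 3) * z f +
    (β' * (z (b 0) * z (b 1) * z (b 2) * z e) + β'' * (z (d 0) * z (d 1) * z (d 2) * z f)) *
      (z (c 0) * z (c 1) * z (c 2))

/-- The complete intersection `X̄* = {F₁ = F₂ = 0}` in the toric variety. -/
def Xbar (K : Geometry.SimplicialComplex ℝ E) (α : Fin 3 → ℂ) (α' α'' : ℂ)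
    (β : Fin 3 → ℂ) (β' β'' : ℂ) : Set (ToricVariety K) :=
  {x | ∃ z, toPoint K z = x ∧ F1 α α' α'' z.1 = 0 ∧ F2 β β' β'' z.1 = 0}

/-- A subset of the toric variety is `G₂*`-symmetric: the cyclic permutation of the homogeneous
coordinates is defined at all points of it, and induces a bijection of it of order dividing three,
although it need not be defined on the whole toric variety. -/
def IsG2Symmetric (K : Geometry.SimplicialComplex ℝ E) (X : Set (ToricVariety K)) : Prop :=
  ∃ φ : Equiv.Perm X, φ ^ 3 = 1 ∧ ∀ (x : X) (z : coxDomain K), toPoint K z = x.1 →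
    ∃ w : coxDomain K, (∀ ρ, w.1 (cyc ρ) = z.1 ρ) ∧ toPoint K w = (φ x).1

end

end NablaBar

namespace NablaBar

open Ray Sum

/-! ### Coordinates -/

/-! Since `b_i = a_i + e` and `c_l = d_l + e`, the twelve vertices lie in pairs on six lines
parallel to `e`: three left lines through the `a_i` and three right lines through the `d_l`. A
combination `c` of the rays equals `∑ mult c x • pt (lo x) + height c • pt e`. Modulo `e` the three
left directions sum to zero, and so do the three right ones. Hence every vector has unique
nonnegative multiplicities vanishing on one left and one right line (`exists_coordinates`,
`mult_eq_of_combo_eq`), and a triangulation only decides how the height is distributed over upper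
points, `e` and `f`.

The relation `hi x + lo y = lo x + hi y` forces a fine star triangulation to contain exactly one of
the edges `{hi x, lo y}` and `{hi y, lo x}`, which defines a tournament on the six lines (`datum`).
A cyclic triple containing lines of both kinds would leave a vector outside every cone
(`IsFineStar.good_datum`); three lines of the same kind never share a cone, so they may form a
cycle. Conversely, without mixed cycles every vector is reached by filling the lines in tournament
order (`exists_upper_parts`), so the cones of the tournament form a complete fan. The tournament
determines the cones, whence the bijection `datum_bijOn`.

The mixed pairs of a tournament form the sign array. Given the array, the left pairs and the right
pairs are constrained separately (`good_iff`), so the counts are products of small Boolean counts.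
Coherence or projectivity makes `h (hi x) - h (lo x)` increase along the tournament, so it excludes
cycles; conversely the ranking of a transitive tournament supplies heights
(`IsFineStar.isCoherent_of_rank`). A `G₂*`-invariant tournament is cyclic on the left lines, hence
neither coherent nor projective.

A cone containing `a_i` and `b_j`, `i ≠ j`, misses `e`, `f` and the third left line. This kills the
products in the intersection ring and leaves one nonzero monomial of `F1`; the right lines behave in
the same way. So only the mixed pairs matter on the complete intersection, and constant signs are
invariant under the cyclic permutation. -/

/-- The six lines of the fan in the direction of `e`. -/
abbrev Line : Type := Fin 3 ⊕ Fin 3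

/-- The lower lattice point on a line. -/
def lo : Line → Ray
  | inl i => a i
  | inr l => d l

/-- The upper lattice point on a line, `pt (hi x) = pt (lo x) + pt e`. -/
def hi : Line → Ray
  | inl i => b i
  | inr l => c l

theorem Ray.sum_eq {M : Type*} [AddCommMonoid M] (g : Ray → M) :
    ∑ ρ, g ρ = ∑ i, g (a i) + ∑ i, g (b i) + ∑ l, g (c l) + ∑ l, g (d l) + g e + g f := by
  have h : (Finset.univ : Finset Ray) = {a 0, a 1, a 2, b 0, b 1, b 2, c 0, c 1, c 2,
    d 0, d 1, d 2, e, f} := by decide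
  rw [h]
  simp [Fin.sum_univ_three, Finset.sum_insert, add_assoc]

theorem Ray.forall_iff {q : Ray → Prop} :
    (∀ ρ, q ρ) ↔ (∀ x, q (lo x)) ∧ (∀ x, q (hi x)) ∧ q e ∧ q f := by
  constructor
  · exact fun h => ⟨fun x => h _, fun x => h _, h _, h _⟩
  · rintro ⟨h1, h2, h3, h4⟩ (i | i | l | l | _ | _)
    exacts [h1 (inl i), h2 (inl i), h2 (inr l), h1 (inr l), h3, h4]

/-- The linear combination of the lattice points with given coefficients. -/
noncomputable def combo (c : Ray → ℝ) : E := ∑ ρ, c ρ • pt ρ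

/-- The total coefficient on a line. -/
def mult (c : Ray → ℝ) (x : Line) : ℝ := c (lo x) + c (hi x)

/-- The coordinate of a linear combination in the direction of `e`. -/
noncomputable def height (c : Ray → ℝ) : ℝ := ∑ x, c (hi x) + c e - c f

theorem height_eq (c : Ray → ℝ) :
    height c = ∑ i, c (b i) + ∑ l, c (Ray.c l) + c e - c f := by
  simp [height, hi]

theorem combo_apply (c : Ray → ℝ) :
    combo c 0 = 2 * mult c (inl 0) - mult c (inl 1) - mult c (inl 2) ∧
    combo c 1 = 2 * mult c (inl 1) - mult c (inl 0) - mult c (inl 2) ∧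
    combo c 2 = mult c (inr 0) + mult c (inr 1) + mult c (inr 2) - height c ∧
    combo c 3 = 2 * mult c (inr 0) - mult c (inr 1) - mult c (inr 2) ∧
    combo c 4 = mult c (inl 2) - mult c (inl 1) + mult c (inr 1) - mult c (inr 0) := by
  refine ⟨?_, ?_, ?_, ?_, ?_⟩ <;>
  · simp [combo, Ray.sum_eq, pt, nu, mult, lo, hi, height_eq, Fin.sum_univ_three]
    ring

/-- A family of multiplicities of the lines vanishing on one line of each kind. -/
def Sparse (m : Line → ℝ) : Prop := (∃ i, m (inl i) = 0) ∧ ∃ l, m (inr l) = 0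

theorem eq_of_sub_eq_sub {m m' : Fin 3 → ℝ} (hm : ∀ i, 0 ≤ m i) (hm' : ∀ i, 0 ≤ m' i)
    (h0 : ∃ i, m i = 0) (h0' : ∃ i, m' i = 0) (h1 : m 0 - m 1 = m' 0 - m' 1)
    (h2 : m 0 - m 2 = m' 0 - m' 2) : m = m' := by
  obtain ⟨i, hi⟩ := h0
  obtain ⟨j, hj⟩ := h0'
  have key (k) : m k = m' k + (m 0 - m' 0) := by fin_cases k <;> simp <;> linarith
  have := hm j
  have := hm' i
  have := key i
  have := key j
  ext k
  linarith [key k]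

/-- Coordinates 0 and 1 determine the differences of the left multiplicities, then coordinates 3 and
4 those of the right ones. The zero of each kind fixes the common shift, and coordinate 2 yields the
height. -/
theorem mult_eq_of_combo_eq {c c' : Ray → ℝ} (hc : ∀ ρ, 0 ≤ c ρ) (hc' : ∀ ρ, 0 ≤ c' ρ)
    (hs : Sparse (mult c)) (hs' : Sparse (mult c')) (h : combo c = combo c') :
    (∀ x, mult c x = mult c' x) ∧ height c = height c' := by
  obtain ⟨h0, h1, h2, h3, h4⟩ := combo_apply c
  obtain ⟨k0, k1, k2, k3, k4⟩ := combo_apply c'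
  rw [← h] at k0 k1 k2 k3 k4
  have hm (x) : 0 ≤ mult c x := add_nonneg (hc _) (hc _)
  have hm' (x) : 0 ≤ mult c' x := add_nonneg (hc' _) (hc' _)
  have hu := eq_of_sub_eq_sub (fun i => hm (inl i)) (fun i => hm' (inl i)) hs.1 hs'.1
    (by linarith) (by linarith)
  have hw := eq_of_sub_eq_sub (fun i => hm (inr i)) (fun i => hm' (inr i)) hs.2 hs'.2
    (by linarith) (by linarith)
  have hx : ∀ x, mult c x = mult c' x
    | inl i => congrFun hu i
    | inr l => congrFun hw l
  exact ⟨hx, by linarith [hx (inr 0), hx (inr 1), hx (inr 2)]⟩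

theorem exists_coordinates (y : E) : ∃ (m : Line → ℝ) (s : ℝ), (∀ x, 0 ≤ m x) ∧ Sparse m ∧
    ∀ c : Ray → ℝ, (∀ x, mult c x = m x) → height c = s → combo c = y := by
  -- `p` and `q` solve the system of `combo_apply` with last entry zero. Subtracting their minima
  -- makes them nonnegative with a zero entry.
  let D : ℝ := y 4 + (y 0 + 2 * y 1) / 3
  let p : Fin 3 → ℝ := ![(2 * y 0 + y 1) / 3, (y 0 + 2 * y 1) / 3, 0]
  let q : Fin 3 → ℝ := ![y 3 + D, y 3 + 2 * D, 0]
  obtain ⟨i, hi⟩ := Finite.exists_min p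
  obtain ⟨l, hl⟩ := Finite.exists_min q
  refine ⟨Sum.elim (fun j => p j - p i) (fun j => q j - q l),
    -y 2 + ∑ j, (q j - q l), ?_, ⟨⟨i, by simp⟩, l, by simp⟩, ?_⟩
  · rintro (j | j)
    · simpa using hi j
    · simpa using hl j
  · intro c hm hh
    obtain ⟨h0, h1, h2, h3, h4⟩ := combo_apply c
    simp only [hm, hh, Sum.elim_inl, Sum.elim_inr, Fin.sum_univ_three] at h0 h1 h2 h3 h4
    simp only [p, q, D, Matrix.cons_val] at h0 h1 h2 h3 h4
    ext k
    fin_cases k <;> simp <;> linarith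

/-! ### Tournaments on the six lines and the associated fans -/

/-- A tournament on the six lines: the signs of the mixed pairs, and the orientation of the pairs
`{i, i + 1}` of lines of the same kind. -/
abbrev Datum : Type := (Fin 3 → Fin 3 → Bool) × (Fin 3 → Bool) × (Fin 3 → Bool)

/-- The first line precedes the second one. -/
def Ord (D : Datum) : Line → Line → Prop
  | inl i, inl j => (j = i + 1 ∧ D.2.1 i = true) ∨ (i = j + 1 ∧ D.2.1 j = false)
  | inr l, inr m => (m = l + 1 ∧ D.2.2 l = true) ∨ (l = m + 1 ∧ D.2.2 m = false)
  | inl i, inr l => D.1 l i = true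
  | inr l, inl i => D.1 l i = false

theorem orient_asymm (p : Fin 3 → Bool) (i j : Fin 3)
    (h : (j = i + 1 ∧ p i = true) ∨ (i = j + 1 ∧ p j = false)) :
    ¬((i = j + 1 ∧ p j = true) ∨ (j = i + 1 ∧ p i = false)) := by
  fin_cases i <;> fin_cases j <;> simp_all

theorem orient_total (p : Fin 3 → Bool) (i j : Fin 3) (hij : i ≠ j) :
    ((j = i + 1 ∧ p i = true) ∨ (i = j + 1 ∧ p j = false)) ∨
      ((i = j + 1 ∧ p j = true) ∨ (j = i + 1 ∧ p i = false)) := by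
  have : j = i + 1 ∨ i = j + 1 := by revert i j; decide
  cases h : p i <;> cases h' : p j <;> tauto

theorem Ord.asymm {D : Datum} {x y : Line} (h : Ord D x y) : ¬ Ord D y x := by
  rcases x with i | l <;> rcases y with j | m
  · exact orient_asymm _ _ _ h
  · simp_all [Ord]
  · simp_all [Ord]
  · exact orient_asymm _ _ _ h

theorem Ord.irrefl {D : Datum} (x : Line) : ¬ Ord D x x := fun h => h.asymm h

theorem Ord.ne {D : Datum} {x y : Line} (h : Ord D x y) : x ≠ y := by
  rintro rfl
  exact Ord.irrefl _ h

theorem Ord.total (D : Datum) {x y : Line} (h : x ≠ y) : Ord D x y ∨ Ord D y x := by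
  rcases x with i | l <;> rcases y with j | m
  · exact orient_total _ _ _ (by simpa using h)
  · cases h : D.1 m i <;> simp_all [Ord]
  · cases h : D.1 l j <;> simp_all [Ord]
  · exact orient_total _ _ _ (by simpa using h)

/-- Three lines of the same kind. -/
def SameKind (x y z : Line) : Prop :=
  (x.isLeft ∧ y.isLeft ∧ z.isLeft) ∨ (x.isRight ∧ y.isRight ∧ z.isRight)

/-- A tournament all of whose cyclic triples consist of lines of the same kind. -/
def Good (D : Datum) : Prop :=
  ∀ x y z, ¬ SameKind x y z → Ord D x y → Ord D y z → Ord D x z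

/-- Conditions satisfied by the cones of all fans of fine star triangulations. -/
structure Thin (I : Set Ray) : Prop where
  e_lo : e ∈ I → ∀ x, lo x ∉ I
  f_hi : f ∈ I → ∀ x, hi x ∉ I
  e_f : e ∈ I → f ∉ I
  left : ∃ i, lo (inl i) ∉ I ∧ hi (inl i) ∉ I
  right : ∃ l, lo (inr l) ∉ I ∧ hi (inr l) ∉ I

/-- The sets of rays of the cones of the fan of a tournament. -/
def Cell (D : Datum) (I : Set Ray) : Prop :=
  Thin I ∧ ∀ x y, x ≠ y → hi x ∈ I → lo y ∈ I → Ord D x y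

theorem Thin.mono {I J : Set Ray} (h : Thin I) (hJ : J ⊆ I) : Thin J where
  e_lo he x hx := h.e_lo (hJ he) x (hJ hx)
  f_hi he x hx := h.f_hi (hJ he) x (hJ hx)
  e_f he hx := h.e_f (hJ he) (hJ hx)
  left := h.left.imp fun _ hi => ⟨fun h => hi.1 (hJ h), fun h => hi.2 (hJ h)⟩
  right := h.right.imp fun _ hi => ⟨fun h => hi.1 (hJ h), fun h => hi.2 (hJ h)⟩

theorem Cell.mono {D : Datum} {I J : Set Ray} (h : Cell D I) (hJ : J ⊆ I) : Cell D J :=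
  ⟨h.1.mono hJ, fun x y hxy hx hy => h.2 x y hxy (hJ hx) (hJ hy)⟩

theorem Thin.sparse {c : Ray → ℝ} (h : Thin (Function.support c)) : Sparse (mult c) := by
  obtain ⟨i, hi⟩ := h.left
  obtain ⟨l, hl⟩ := h.right
  simp only [Function.mem_support, not_not] at hi hl
  exact ⟨⟨i, by simp [mult, hi]⟩, l, by simp [mult, hl]⟩

/-- Next to `e` all lower points are absent, so its coefficient is the excess of the height over the
total multiplicity. Next to `f` all upper points are absent, so its coefficient is the deficit below
zero. -/
theorem Thin.coeff_eq {c : Ray → ℝ} (hc : ∀ ρ, 0 ≤ c ρ) (h : Thin (Function.support c)) :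
    c e = max (height c - ∑ x, mult c x) 0 ∧ c f = max (-height c) 0 := by
  have e_lo := h.e_lo
  have f_hi := h.f_hi
  have e_f := h.e_f
  simp only [Function.mem_support, not_not] at e_lo f_hi e_f
  have hmult : ∑ x, mult c x = ∑ x, c (lo x) + ∑ x, c (hi x) := Finset.sum_add_distrib
  have hlo : 0 ≤ ∑ x, c (lo x) := Finset.sum_nonneg fun x _ => hc _
  have hhi : 0 ≤ ∑ x, c (hi x) := Finset.sum_nonneg fun x _ => hc _
  have he := hc e
  have hf := hc f
  rw [hmult, height]
  by_cases h1 : c e = 0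
  · by_cases h2 : c f = 0
    · rw [max_eq_right, max_eq_right] <;> [exact ⟨h1, h2⟩; linarith; linarith]
    · simp only [f_hi h2, Finset.sum_const_zero] at hhi ⊢
      rw [max_eq_right, max_eq_left] <;> [constructor; skip; skip] <;> linarith
  · simp only [e_lo h1, e_f h1, Finset.sum_const_zero] at hlo ⊢
    rw [max_eq_left, max_eq_right] <;> [constructor; skip; skip] <;> linarith

/-- The relative interiors of the cones of the fan of a tournament are disjoint. -/
theorem Cell.unique {D : Datum} {c c' : Ray → ℝ} (hc : ∀ ρ, 0 ≤ c ρ) (hc' : ∀ ρ, 0 ≤ c' ρ)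
    (h : Cell D (Function.support c)) (h' : Cell D (Function.support c'))
    (heq : combo c = combo c') : c = c' := by
  obtain ⟨hm, hh⟩ := mult_eq_of_combo_eq hc hc' h.1.sparse h'.1.sparse heq
  have he : c e = c' e := by
    rw [(h.1.coeff_eq hc).1, (h'.1.coeff_eq hc').1, hh, Finset.sum_congr rfl fun x _ => hm x]
  have hf : c f = c' f := by rw [(h.1.coeff_eq hc).2, (h'.1.coeff_eq hc').2, hh]
  have hsum : ∑ x, c (hi x) = ∑ x, c' (hi x) := by
    simp only [height] at hh
    linarith
  have hhi : ∀ x, c (hi x) = c' (hi x) := by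
    by_cases h1 : ∀ x, c (hi x) ≤ c' (hi x)
    · exact fun x => (Finset.sum_eq_sum_iff_of_le fun x _ => h1 x).1 hsum x (Finset.mem_univ x)
    by_cases h2 : ∀ x, c' (hi x) ≤ c (hi x)
    · exact fun x =>
        ((Finset.sum_eq_sum_iff_of_le fun x _ => h2 x).1 hsum.symm x (Finset.mem_univ x)).symm
    push Not at h1 h2
    -- The upper parts have equal sums, so they differ in both directions. Equal multiplicities then
    -- put `hi x`, `lo y` into the support of `c` and `hi y`, `lo x` into that of `c'`: opposite
    -- orientations of one pair.
    obtain ⟨x, hx⟩ := h1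
    obtain ⟨y, hy⟩ := h2
    have hxy : x ≠ y := by
      rintro rfl
      exact lt_asymm hx hy
    have hmx := hm x
    have hmy := hm y
    simp only [mult] at hmx hmy
    refine absurd (h.2 x y hxy ?_ ?_) (h'.2 y x hxy.symm ?_ ?_).asymm
    · exact ((hc' _).trans_lt hx).ne'
    · exact (show 0 < c (lo y) by linarith [hc' (lo y)]).ne'
    · exact ((hc _).trans_lt hy).ne'
    · exact (show 0 < c' (lo x) by linarith [hc (lo x)]).ne'
  funext ρ
  revert ρ
  rw [Ray.forall_iff]
  refine ⟨fun x => ?_, hhi, he, hf⟩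
  have := hm x
  simp only [mult, hhi x] at this
  linarith

/-! ### Completeness of the fan of a good tournament -/

/-- Coefficients with prescribed multiplicities and upper parts. -/
def coeffs (m α : Line → ℝ) (ce cf : ℝ) : Ray → ℝ
  | a i => m (inl i) - α (inl i)
  | b i => α (inl i)
  | c l => α (inr l)
  | d l => m (inr l) - α (inr l)
  | e => ce
  | f => cf

theorem coeffs_lo (m α : Line → ℝ) (ce cf : ℝ) (x : Line) :
    coeffs m α ce cf (lo x) = m x - α x := by cases x <;> rfl

theorem coeffs_hi (m α : Line → ℝ) (ce cf : ℝ) (x : Line) :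
    coeffs m α ce cf (hi x) = α x := by cases x <;> rfl

theorem mult_coeffs (m α : Line → ℝ) (ce cf : ℝ) (x : Line) :
    mult (coeffs m α ce cf) x = m x := by
  simp [mult, coeffs_lo, coeffs_hi]

theorem height_coeffs (m α : Line → ℝ) (ce cf : ℝ) :
    height (coeffs m α ce cf) = ∑ x, α x + ce - cf := by
  simp only [height, coeffs_hi]
  rfl

/-- Liquid poured into the lines in tournament order: each line starts to fill once the capacity of
its predecessors is used up. The intermediate value theorem finds the level with total `s`. -/
theorem exists_upper_parts (m : Line → ℝ) (hm : ∀ x, 0 ≤ m x) (hs : Sparse m) {D : Datum}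
    (hD : Good D) {s : ℝ} (h0 : 0 ≤ s) (hs1 : s ≤ ∑ x, m x) :
    ∃ α : Line → ℝ, (∀ x, 0 ≤ α x ∧ α x ≤ m x) ∧ ∑ x, α x = s ∧
      ∀ x y, x ≠ y → 0 < α x → α y < m y → Ord D x y := by
  classical
  -- `B x` is the level at which `x` starts to fill, and `α r x` below is its content at level `r`.
  let B : Line → ℝ := fun x => ∑ y with Ord D y x, m y
  have hB (x) : 0 ≤ B x := Finset.sum_nonneg fun y _ => hm y
  let α : ℝ → Line → ℝ := fun r x => max 0 (min (r - B x) (m x))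
  have hα (r x) : 0 ≤ α r x ∧ α r x ≤ m x :=
    ⟨le_max_left _ _, max_le (hm x) (min_le_right _ _)⟩
  have hcont : Continuous fun r => ∑ x, α r x := by fun_prop
  have hBm (x) : B x + m x ≤ ∑ y, m y := by
    rw [← Finset.sum_erase_add _ _ (Finset.mem_univ x)]
    refine add_le_add_left (Finset.sum_le_sum_of_subset_of_nonneg ?_ fun y _ _ => hm y) _
    intro y hy
    rw [Finset.mem_filter] at hy
    exact Finset.mem_erase.2 ⟨hy.2.ne, hy.1⟩
  have hzero : ∑ x, α 0 x = 0 := Finset.sum_eq_zero fun x _ =>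
    max_eq_left ((min_le_left _ _).trans (by linarith [hB x]))
  have hone : ∑ x, α (∑ y, m y) x = ∑ x, m x := Finset.sum_congr rfl fun x _ => by
    simp only [α]
    rw [min_eq_right (by linarith [hBm x]), max_eq_right (hm x)]
  obtain ⟨r, -, hr⟩ := intermediate_value_Icc (Finset.sum_nonneg fun x _ => hm x)
    hcont.continuousOn ⟨hzero.trans_le h0, hs1.trans_eq hone.symm⟩
  refine ⟨α r, hα r, hr, fun x y hxy hx hy => (Ord.total D hxy).resolve_right fun hyx => ?_⟩
  have hr1 : B x < r := by
    by_contra! hle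
    refine hx.ne' (max_eq_left ((min_le_left _ _).trans (by linarith)))
  have hr2 : r < B y + m y := by
    by_contra! hle
    refine hy.not_ge (le_max_of_le_right (le_min (by linarith) le_rfl))
  have hmx : 0 < m x := hx.trans_le (hα r x).2
  have hmy : 0 < m y := (hα r y).1.trans_lt hy
  -- If `y` precedes `x`, so do all predecessors of `y` of nonzero capacity; then `y` is full before
  -- `x` starts.
  have hBxy : B y + m y ≤ B x := by
    have h1 : B y = ∑ z with Ord D z y ∧ m z ≠ 0, m z := by
      simp only [B]
      rw [← Finset.filter_filter, Finset.sum_filter_ne_zero]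
    have hy' : y ∉ ({z | Ord D z y ∧ m z ≠ 0} : Finset Line) := by
      simp [Ord.irrefl]
    rw [h1, add_comm, ← Finset.sum_insert hy']
    refine Finset.sum_le_sum_of_subset_of_nonneg ?_ fun z _ _ => hm z
    intro z hz
    simp only [Finset.mem_insert, Finset.mem_filter, Finset.mem_univ, true_and] at hz ⊢
    rcases hz with rfl | ⟨hzy, hmz⟩
    · exact hyx
    -- Three distinct lines of one kind would include the line of that kind with multiplicity zero,
    -- so this triple is mixed.
    · refine hD z y x ?_ hzy hyx
      obtain ⟨⟨i, hi⟩, l, hl⟩ := hs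
      have h1 := hzy.ne
      have h2 : z ≠ x := by
        rintro rfl
        exact hzy.asymm hyx
      rintro (h | h)
      · rcases z with z | z <;> rcases y with y | y <;> rcases x with x | x <;> simp at h
        have : i = z ∨ i = y ∨ i = x := by
          revert hxy h1 h2; simp only [ne_eq, Sum.inl.injEq]; clear * -; revert z y x i; decide
        rcases this with rfl | rfl | rfl <;> simp_all
      · rcases z with z | z <;> rcases y with y | y <;> rcases x with x | x <;> simp at h
        have : l = z ∨ l = y ∨ l = x := by
          revert hxy h1 h2; simp only [ne_eq, Sum.inr.injEq]; clear * -; revert z y x l; decide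
        rcases this with rfl | rfl | rfl <;> simp_all
  linarith

theorem Sparse.left {m : Line → ℝ} (hs : Sparse m) {α : Line → ℝ} (hα : ∀ x, 0 ≤ α x ∧ α x ≤ m x)
    (ce cf : ℝ) : ∃ i, lo (inl i) ∉ Function.support (coeffs m α ce cf) ∧
      hi (inl i) ∉ Function.support (coeffs m α ce cf) := by
  obtain ⟨i, hi⟩ := hs.1
  have := hα (inl i)
  refine ⟨i, ?_, ?_⟩ <;> simp only [Function.mem_support, not_not, coeffs_lo, coeffs_hi] <;>
    linarith

theorem Sparse.right {m : Line → ℝ} (hs : Sparse m) {α : Line → ℝ}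
    (hα : ∀ x, 0 ≤ α x ∧ α x ≤ m x)
    (ce cf : ℝ) : ∃ l, lo (inr l) ∉ Function.support (coeffs m α ce cf) ∧
      hi (inr l) ∉ Function.support (coeffs m α ce cf) := by
  obtain ⟨i, hi⟩ := hs.2
  have := hα (inr i)
  refine ⟨i, ?_, ?_⟩ <;> simp only [Function.mem_support, not_not, coeffs_lo, coeffs_hi] <;>
    linarith

/-- The fan of a good tournament is complete. -/
theorem Good.exists_cell {D : Datum} (hD : Good D) (y : E) :
    ∃ c : Ray → ℝ, (∀ ρ, 0 ≤ c ρ) ∧ Cell D (Function.support c) ∧ combo c = y := by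
  obtain ⟨m, s, hm, hs, hy⟩ := exists_coordinates y
  suffices h : ∃ (α : Line → ℝ) (ce cf : ℝ), (∀ x, 0 ≤ α x ∧ α x ≤ m x) ∧ 0 ≤ ce ∧ 0 ≤ cf ∧
      ∑ x, α x + ce - cf = s ∧ (ce ≠ 0 → ∀ x, α x = m x) ∧ (cf ≠ 0 → ∀ x, α x = 0) ∧
      (ce ≠ 0 → cf = 0) ∧ ∀ x y, x ≠ y → 0 < α x → α y < m y → Ord D x y by
    obtain ⟨α, ce, cf, hα, hce, hcf, hsum, he, hf, hef, hord⟩ := h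
    refine ⟨coeffs m α ce cf, ?_, ⟨⟨?_, ?_, ?_, hs.left hα _ _, hs.right hα _ _⟩, ?_⟩,
      hy _ (mult_coeffs _ _ _ _) ((height_coeffs _ _ _ _).trans hsum)⟩
    · rw [Ray.forall_iff]
      simp only [coeffs_lo, coeffs_hi, sub_nonneg]
      exact ⟨fun x => (hα x).2, fun x => (hα x).1, hce, hcf⟩
    · intro h x
      simp [coeffs_lo, he h x]
    · intro h x
      simp [coeffs_hi, hf h x]
    · exact fun h h' => h' (hef h)
    · intro x y hxy hx hy
      rw [Function.mem_support, coeffs_hi] at hx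
      rw [Function.mem_support, coeffs_lo] at hy
      exact hord x y hxy (lt_of_le_of_ne (hα x).1 hx.symm)
        (lt_of_le_of_ne (hα y).2 fun h => hy (by rw [h, sub_self]))
  -- A negative height is carried by `f`, an excess over the total multiplicity by `e`, anything in
  -- between by the upper points alone.
  by_cases h0 : s < 0
  · refine ⟨0, 0, -s, fun x => ⟨le_rfl, hm x⟩, le_rfl, by linarith, by simp, by simp, by simp,
      by simp, by simp⟩
  by_cases h1 : ∑ x, m x < s
  · refine ⟨m, s - ∑ x, m x, 0, fun x => ⟨hm x, le_rfl⟩, by linarith, le_rfl, by simp, by simp,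
      by simp, by simp, by simp⟩
  obtain ⟨α, hα, hsum, hord⟩ := exists_upper_parts m hm hs hD (not_lt.1 h0) (not_lt.1 h1)
  exact ⟨α, 0, 0, hα, le_rfl, le_rfl, by simpa using hsum, by simp, by simp, by simp, hord⟩

open Set

/-! ### The polytope -/

theorem nu_injective : Function.Injective nu := by decide

theorem nu_ne_zero (ρ : Ray) : nu ρ ≠ 0 := by revert ρ; decide

theorem pt_injective : Function.Injective pt := by
  intro ρ ρ' h
  refine nu_injective (funext fun k => ?_)
  have := congrFun h k
  simp only [pt] at this
  exact_mod_cast this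

theorem pt_ne_zero (ρ : Ray) : pt ρ ≠ 0 := by
  intro h
  refine nu_ne_zero ρ (funext fun k => ?_)
  have := congrFun h k
  simp only [pt, Pi.zero_apply] at this
  exact_mod_cast this

theorem combo_single (ρ : Ray) : combo (Pi.single ρ 1) = pt ρ := by
  simp [combo, Pi.single_apply, ite_smul]

theorem combo_add (c c' : Ray → ℝ) : combo (c + c') = combo c + combo c' := by
  simp [combo, add_smul, Finset.sum_add_distrib]

theorem combo_smul (r : ℝ) (c : Ray → ℝ) : combo (r • c) = r • combo c := by
  simp [combo, Finset.smul_sum, mul_smul]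

theorem combo_zero : combo 0 = 0 := by simp [combo]

/-- The origin and the lattice points labelled by the rays. -/
def points : Set E := insert 0 (range pt)

/-- The points of convex hulls of lattice points, in terms of coefficients. -/
theorem mem_convexHull_iff {s : Set E} (hs : s ⊆ points) {y : E} :
    y ∈ convexHull ℝ s ↔ ∃ c : Ray → ℝ, (∀ ρ, 0 ≤ c ρ) ∧ (∀ ρ, c ρ ≠ 0 → pt ρ ∈ s) ∧
      ∑ ρ, c ρ ≤ 1 ∧ (∑ ρ, c ρ ≠ 1 → (0 : E) ∈ s) ∧ combo c = y := by
  constructor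
  · intro hy
    refine convexHull_min (t := {y | ∃ c : Ray → ℝ, (∀ ρ, 0 ≤ c ρ) ∧ (∀ ρ, c ρ ≠ 0 → pt ρ ∈ s) ∧
      ∑ ρ, c ρ ≤ 1 ∧ (∑ ρ, c ρ ≠ 1 → (0 : E) ∈ s) ∧ combo c = y}) ?_ ?_ hy
    · intro x hx
      rcases hs hx with rfl | ⟨ρ, rfl⟩
      · exact ⟨0, by simp, by simp, by simp, fun _ => hx, combo_zero⟩
      · refine ⟨Pi.single ρ 1, fun ρ' => ?_, fun ρ' h => ?_, by simp, by simp, combo_single ρ⟩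
        · by_cases h : ρ' = ρ <;> simp [h]
        · by_cases h' : ρ' = ρ
          · rwa [h']
          · simp [h'] at h
    · rintro x ⟨c, h1, h2, h3, h4, rfl⟩ y ⟨c', h1', h2', h3', h4', rfl⟩ r r' hr hr' hrr
      refine ⟨r • c + r' • c', fun ρ => ?_, fun ρ h => ?_, ?_, fun h => ?_, ?_⟩
      · exact add_nonneg (mul_nonneg hr (h1 ρ)) (mul_nonneg hr' (h1' ρ))
      · by_cases hc : c ρ = 0
        · exact h2' ρ fun hc' => h (by simp [hc, hc'])
        · exact h2 ρ hc
      · simp only [Pi.add_apply, Pi.smul_apply, smul_eq_mul, Finset.sum_add_distrib,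
          ← Finset.mul_sum]
        nlinarith
      · simp only [Pi.add_apply, Pi.smul_apply, smul_eq_mul, Finset.sum_add_distrib,
          ← Finset.mul_sum] at h
        by_cases hc : ∑ ρ, c ρ = 1
        · exact h4' fun hc' => h (by rw [hc, hc', mul_one, mul_one, hrr])
        · exact h4 hc
      · rw [combo_add, combo_smul, combo_smul]
  · rintro ⟨c, h1, h2, h3, h4, rfl⟩
    have hconv := convex_convexHull ℝ s
    have hsum : ∑ ρ with c ρ ≠ 0, c ρ = ∑ ρ, c ρ := Finset.sum_filter_ne_zero _
    by_cases h0 : ∑ ρ, c ρ = 0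
    · have hc : c = 0 := funext fun ρ =>
        (Finset.sum_eq_zero_iff_of_nonneg fun ρ _ => h1 ρ).1 h0 ρ (Finset.mem_univ ρ)
      rw [hc, combo_zero]
      exact subset_convexHull ℝ s (h4 (by rw [h0]; exact zero_ne_one))
    have hpos : 0 < ∑ ρ, c ρ := lt_of_le_of_ne (Finset.sum_nonneg fun ρ _ => h1 ρ) (Ne.symm h0)
    have hz : (∑ ρ, c ρ)⁻¹ • combo c ∈ convexHull ℝ s := by
      have : (∑ ρ, c ρ)⁻¹ • combo c = ∑ ρ with c ρ ≠ 0, ((∑ ρ, c ρ)⁻¹ * c ρ) • pt ρ := by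
        rw [combo, Finset.smul_sum, Finset.sum_filter_of_ne]
        · simp only [mul_smul]
        · intro ρ _ h hc
          simp [hc] at h
      rw [this]
      refine hconv.sum_mem (fun ρ _ => mul_nonneg (inv_nonneg.2 hpos.le) (h1 ρ)) ?_ ?_
      · rw [← Finset.mul_sum, hsum, inv_mul_cancel₀ h0]
      · exact fun ρ hρ => subset_convexHull ℝ s (h2 ρ (Finset.mem_filter.1 hρ).2)
    have hy : combo c = (∑ ρ, c ρ) • (∑ ρ, c ρ)⁻¹ • combo c := (smul_inv_smul₀ h0 _).symm
    by_cases hone : ∑ ρ, c ρ = 1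
    · rwa [hone, inv_one, one_smul] at hz
    · rw [hy]
      exact hconv.smul_mem_of_zero_mem (subset_convexHull ℝ s (h4 hone)) hz ⟨hpos.le, h3⟩

/-- The linear form with integer coefficients `m`. -/
def form (m : Fin 5 → ℤ) : E →ₗ[ℝ] ℝ := ∑ k, (m k : ℝ) • LinearMap.proj k

theorem form_apply (m : Fin 5 → ℤ) (y : E) : form m y = ∑ k, m k * y k := by
  simp [form]

theorem form_pt (m : Fin 5 → ℤ) (ρ : Ray) : form m (pt ρ) = (∑ k, m k * nu ρ k : ℤ) := by
  simp [form_apply, pt]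

theorem form_combo (m : Fin 5 → ℤ) (c : Ray → ℝ) :
    form m (combo c) = ∑ ρ, c ρ * (∑ k, m k * nu ρ k : ℤ) := by
  simp only [combo, map_sum, map_smul, form_pt, smul_eq_mul]

/-- The form with the values `1` on `a_i`, `b_i` for `i ≠ k`, and `-2` on `a_k`, `b_k`. -/
def formA : Fin 3 → Fin 5 → ℤ :=
  ![![-1, 0, 0, 0, 0], ![0, -1, 0, 0, 0], ![1, 1, 0, 0, 0]]

/-- The form with the values `1` on `c_l`, `d_l` for `l ≠ k`, and `-2` on `c_k`, `d_k`. -/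
def formC : Fin 3 → Fin 5 → ℤ :=
  ![![0, 0, 0, -1, 0], ![-1, -2, 0, -1, -3], ![1, 2, 0, 2, 3]]

/-- The form with the value `1` on `e` which vanishes on `a_i` and `c_l`. -/
def formE : Fin 5 → ℤ := ![0, 0, -1, 0, 0]

/-- The forms defining the facets of the polytope. -/
def facetForm : (Fin 3 × Fin 3) ⊕ (Fin 3 ⊕ Fin 3) → Fin 5 → ℤ
  | inl (k, l) => formA k + formC l
  | inr (inl l) => formE + formC l
  | inr (inr k) => formA k - formE

theorem facetForm_nu_le : ∀ j ρ, ∑ k, facetForm j k * nu ρ k ≤ 1 := by decide +kernel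

/-- The rays of a thin set lie on a common facet of the polytope. Sums of coefficients thereby
become values of a form bounded by 1 on the polytope. -/
theorem Thin.exists_facetForm {I : Set Ray} (h : Thin I) :
    ∃ j, ∀ ρ ∈ I, ∑ k, facetForm j k * nu ρ k = 1 := by
  obtain ⟨i, hi1, hi2⟩ := h.left
  obtain ⟨l, hl1, hl2⟩ := h.right
  have e_lo := h.e_lo
  have f_hi := h.f_hi
  have e_f := h.e_f
  by_cases he : e ∈ I
  · refine ⟨inr (inl l), fun ρ hρ => ?_⟩
    have key : ∀ l ρ, (ρ = f ∨ (∃ x, ρ = lo x) ∨ ρ = hi (inr l)) ∨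
        ∑ k, facetForm (inr (inl l)) k * nu ρ k = 1 := by decide +kernel
    refine (key l ρ).resolve_left ?_
    rintro (rfl | ⟨x, rfl⟩ | rfl)
    exacts [e_f he hρ, e_lo he x hρ, hl2 hρ]
  by_cases hf : f ∈ I
  · refine ⟨inr (inr i), fun ρ hρ => ?_⟩
    have key : ∀ i ρ, (ρ = e ∨ (∃ x, ρ = hi x) ∨ ρ = lo (inl i)) ∨
        ∑ k, facetForm (inr (inr i)) k * nu ρ k = 1 := by decide +kernel
    refine (key i ρ).resolve_left ?_
    rintro (rfl | ⟨x, rfl⟩ | rfl)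
    exacts [he hρ, f_hi hf x hρ, hi1 hρ]
  · refine ⟨inl (i, l), fun ρ hρ => ?_⟩
    have key : ∀ i l ρ, (ρ = e ∨ ρ = f ∨ ρ = lo (inl i) ∨ ρ = hi (inl i) ∨ ρ = lo (inr l) ∨
        ρ = hi (inr l)) ∨ ∑ k, facetForm (inl (i, l)) k * nu ρ k = 1 := by decide +kernel
    refine (key i l ρ).resolve_left ?_
    rintro (rfl | rfl | rfl | rfl | rfl | rfl)
    exacts [he hρ, hf hρ, hi1 hρ, hi2 hρ, hl1 hρ, hl2 hρ]

theorem pt_mem_polytope (ρ : Ray) : pt ρ ∈ polytope := by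
  have h1 : deltaBar1 ⊆ polytope := subset_union_left.trans (subset_convexHull ℝ _)
  have h2 : deltaBar2 ⊆ polytope := subset_union_right.trans (subset_convexHull ℝ _)
  have hb (i) : pt (b i) ∈ polytope := h1 (subset_convexHull ℝ _ (by simp))
  have hd (l) : pt (d l) ∈ polytope := h2 (subset_convexHull ℝ _ (by simp))
  have hconv : Convex ℝ polytope := convex_convexHull ℝ _
  have hw : ∑ _i : Fin 3, (1 / 3 : ℝ) = 1 := by norm_num
  rcases ρ with i | i | l | l | _ | _
  · exact h1 (subset_convexHull ℝ _ (by simp))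
  · exact hb i
  · exact h2 (subset_convexHull ℝ _ (by simp))
  · exact hd l
  -- `e` is the centroid of the `b_i`, and `f` that of the `d_l`.
  · convert hconv.sum_mem (t := Finset.univ) (fun i _ => by norm_num) hw fun i _ => hb i
    ext k
    fin_cases k <;> simp [pt, nu, Fin.sum_univ_three] <;> norm_num
  · convert hconv.sum_mem (t := Finset.univ) (fun i _ => by norm_num) hw fun i _ => hd i
    ext k
    fin_cases k <;> simp [pt, nu, Fin.sum_univ_three] <;> norm_num

theorem zero_mem_polytope : (0 : E) ∈ polytope :=
  subset_convexHull ℝ _ (Or.inl (subset_convexHull ℝ _ (by simp)))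

theorem points_subset_polytope : points ⊆ polytope := by
  rintro x (rfl | ⟨ρ, rfl⟩)
  exacts [zero_mem_polytope, pt_mem_polytope ρ]

theorem facetForm_le_of_mem_polytope {y : E} (hy : y ∈ polytope)
    (j : (Fin 3 × Fin 3) ⊕ (Fin 3 ⊕ Fin 3)) : form (facetForm j) y ≤ 1 := by
  have hconv : Convex ℝ {y | form (facetForm j) y ≤ 1} :=
    convex_halfSpace_le (form (facetForm j)).isLinear 1
  have hpt (ρ) : form (facetForm j) (pt ρ) ≤ 1 := by
    rw [form_pt]
    exact_mod_cast facetForm_nu_le j ρ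
  have h0 : form (facetForm j) 0 ≤ 1 := by simp
  refine convexHull_min (union_subset ?_ ?_) hconv hy <;>
  · refine convexHull_min ?_ hconv
    rintro x ((rfl | ⟨i, rfl⟩) | ⟨i, rfl⟩)
    exacts [h0, hpt _, hpt _]

/-- The facet inequalities confine lattice points to this box of 576 candidates, as checked in
`eq_zero_or_eq_nu`. -/
theorem lattice_search : ∀ (x₀ x₁ : Fin 4) (x₂ : Fin 3) (x₃ : Fin 4) (x₄ : Fin 3),
    (∀ j, ∑ k, facetForm j k *
      (![(x₀ : ℤ) - 1, (x₁ : ℤ) - 1, (x₂ : ℤ) - 1, (x₃ : ℤ) - 1, (x₄ : ℤ) - 1] : Fin 5 → ℤ) k ≤ 1) →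
    ![(x₀ : ℤ) - 1, (x₁ : ℤ) - 1, (x₂ : ℤ) - 1, (x₃ : ℤ) - 1, (x₄ : ℤ) - 1] = 0 ∨
    ∃ ρ, ![(x₀ : ℤ) - 1, (x₁ : ℤ) - 1, (x₂ : ℤ) - 1, (x₃ : ℤ) - 1, (x₄ : ℤ) - 1] = nu ρ := by
  decide +kernel

theorem eq_zero_or_eq_nu (n : Fin 5 → ℤ) (h : ∀ j, ∑ k, facetForm j k * n k ≤ 1) :
    n = 0 ∨ ∃ ρ, n = nu ρ := by
  have hP (k l) := h (inl (k, l))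
  have hQ (l) := h (inr (inl l))
  have hR (k) := h (inr (inr k))
  have h00 := hP 0 0
  have h01 := hP 0 1
  have h02 := hP 0 2
  have h10 := hP 1 0
  have h11 := hP 1 1
  have h12 := hP 1 2
  have h20 := hP 2 0
  have h21 := hP 2 1
  have h22 := hP 2 2
  have q0 := hQ 0
  have q1 := hQ 1
  have q2 := hQ 2
  have r0 := hR 0
  have r1 := hR 1
  have r2 := hR 2
  simp [facetForm, formA, formC, Fin.sum_univ_five] at h00 h01 h02 h10 h11 h12 h20 h21 h22
  simp [facetForm, formA, formC, formE, Fin.sum_univ_five] at q0 q1 q2 r0 r1 r2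
  have key (x : ℤ) (N : ℕ) (h1 : -1 ≤ x) (h2 : x + 1 < N) : ∃ z : Fin N, x = (z : ℤ) - 1 :=
    ⟨⟨(x + 1).toNat, by omega⟩, by simp; omega⟩
  obtain ⟨x₀, h0⟩ := key (n 0) 4 (by omega) (by omega)
  obtain ⟨x₁, h1⟩ := key (n 1) 4 (by omega) (by omega)
  obtain ⟨x₂, h2⟩ := key (n 2) 3 (by omega) (by omega)
  obtain ⟨x₃, h3⟩ := key (n 3) 4 (by omega) (by omega)
  obtain ⟨x₄, h4⟩ := key (n 4) 3 (by omega) (by omega)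
  have hn : n = ![(x₀ : ℤ) - 1, (x₁ : ℤ) - 1, (x₂ : ℤ) - 1, (x₃ : ℤ) - 1, (x₄ : ℤ) - 1] := by
    ext k
    fin_cases k <;> assumption
  rw [hn] at h ⊢
  exact lattice_search x₀ x₁ x₂ x₃ x₄ h

theorem latticePoints_eq : latticePoints = points := by
  ext y
  constructor
  · rintro ⟨hy, n, rfl⟩
    have h : ∀ j, ∑ k, facetForm j k * n k ≤ 1 := fun j => by
      have := facetForm_le_of_mem_polytope hy j
      rw [form_apply] at this
      exact_mod_cast this
    rcases eq_zero_or_eq_nu n h with rfl | ⟨ρ, rfl⟩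
    · left
      ext k
      simp
    · exact Or.inr ⟨ρ, rfl⟩
  · intro hy
    refine ⟨points_subset_polytope hy, ?_⟩
    rcases hy with rfl | ⟨ρ, rfl⟩
    · exact ⟨0, by ext; simp⟩
    · exact ⟨nu ρ, rfl⟩

variable {K : Geometry.SimplicialComplex ℝ E}

/-! ### The fan of a fine star triangulation -/

theorem Together.mono {I J : Set Ray} (h : Together K I) (hJ : J ⊆ I) : Together K J := by
  obtain ⟨s, hs, h⟩ := h
  exact ⟨s, hs, fun ρ hρ => h ρ (hJ hρ)⟩

theorem points_finite : points.Finite := (finite_range pt).insert 0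

theorem IsFineStar.face_subset (hK : IsFineStar K) {s : Finset E} (hs : s ∈ K.faces) :
    (s : Set E) ⊆ points := by
  rw [← latticePoints_eq, ← hK.vertices_eq, Geometry.SimplicialComplex.vertices_eq]
  exact subset_biUnion_of_mem (u := fun s : Finset E => (s : Set E)) hs

theorem IsFineStar.exists_facet (hK : IsFineStar K) {s : Finset E} (hs : s ∈ K.faces) :
    ∃ t ∈ K.facets, s ⊆ t ∧ (0 : E) ∈ t := by
  have hfin : K.faces.Finite := by
    refine points_finite.toFinset.powerset.finite_toSet.subset fun t ht => ?_
    simpa using hK.face_subset ht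
  obtain ⟨t, hst, ht⟩ := hfin.exists_le_maximal hs
  have htf : t ∈ K.facets := ⟨ht.prop, fun u hu htu => Finset.Subset.antisymm htu (ht.2 hu htu)⟩
  exact ⟨t, htf, hst, hK.star t htf⟩

theorem IsFineStar.together_singleton (hK : IsFineStar K) (ρ : Ray) : Together K {ρ} := by
  have : pt ρ ∈ K.vertices := by
    rw [hK.vertices_eq, latticePoints_eq]
    exact Or.inr ⟨ρ, rfl⟩
  exact ⟨{pt ρ}, this, by simp⟩

theorem IsFineStar.exists_together_facet (hK : IsFineStar K) {I : Set Ray} (h : Together K I) :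
    ∃ s ∈ K.facets, (0 : E) ∈ s ∧ ∀ ρ ∈ I, pt ρ ∈ s := by
  obtain ⟨s, hs, hI⟩ := h
  obtain ⟨t, ht, hst, h0⟩ := hK.exists_facet hs
  exact ⟨t, ht, h0, fun ρ hρ => hst (hI ρ hρ)⟩

theorem IsFineStar.mem_faces_iff (hK : IsFineStar K) {s : Finset E} :
    s ∈ K.faces ↔ s.Nonempty ∧ (s : Set E) ⊆ points ∧ Together K {ρ | pt ρ ∈ s} := by
  constructor
  · exact fun hs => ⟨K.nonempty_of_mem_faces hs, hK.face_subset hs, s, hs, fun ρ hρ => hρ⟩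
  · rintro ⟨hne, hsub, h⟩
    obtain ⟨t, ht, h0, hst⟩ := hK.exists_together_facet h
    refine K.down_closed ht.1 (fun x hx => ?_) hne
    rcases hsub hx with rfl | ⟨ρ, rfl⟩
    exacts [h0, hst ρ hx]

theorem IsFineStar.ext {K' : Geometry.SimplicialComplex ℝ E} (hK : IsFineStar K)
    (hK' : IsFineStar K') (h : ∀ I, Together K I ↔ Together K' I) : K = K' := by
  ext s
  rw [hK.mem_faces_iff, hK'.mem_faces_iff, h]

theorem linearIndependent_of_face {s : Finset E} (hs : s ∈ K.faces) (h0 : (0 : E) ∈ s) :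
    LinearIndependent ℝ (fun ρ : {ρ // pt ρ ∈ s} => pt ρ) := by
  have h := (affineIndependent_iff_linearIndependent_vsub ℝ _ (⟨0, h0⟩ : s)).1 (K.indep hs)
  let g : {ρ // pt ρ ∈ s} → {x : s // x ≠ ⟨0, h0⟩} := fun ρ =>
    ⟨⟨pt ρ, ρ.2⟩, fun h => pt_ne_zero ρ (congrArg Subtype.val h)⟩
  have hg : Function.Injective g := fun ρ ρ' h =>
    Subtype.ext (pt_injective (congrArg (fun x => (x.1.1 : E)) h))
  have h2 := h.comp g hg
  simpa [Function.comp_def, g] using h2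

theorem coeff_unique_of_linearIndependent {s : Set E}
    (hs : LinearIndependent ℝ (fun ρ : {ρ // pt ρ ∈ s} => pt ρ)) {c c' : Ray → ℝ}
    (hc : ∀ ρ, c ρ ≠ 0 → pt ρ ∈ s) (hc' : ∀ ρ, c' ρ ≠ 0 → pt ρ ∈ s)
    (h : combo c = combo c') : c = c' := by
  classical
  have key := Fintype.linearIndependent_iff.1 hs (fun ρ => c ρ - c' ρ) (by
    have h1 : ∑ ρ, (c ρ - c' ρ) • pt ρ = 0 := by
      simp only [sub_smul, Finset.sum_sub_distrib]
      exact sub_eq_zero.2 h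
    rw [← Fintype.sum_subtype_add_sum_subtype (fun ρ => pt ρ ∈ s),
      Finset.sum_eq_zero (s := (Finset.univ : Finset {ρ // pt ρ ∉ s})), add_zero] at h1
    · exact h1
    · rintro ⟨ρ, hρ⟩ -
      simp [not_imp_comm.1 (hc ρ) hρ, not_imp_comm.1 (hc' ρ) hρ])
  funext ρ
  by_cases hρ : pt ρ ∈ s
  · exact sub_eq_zero.1 (key ⟨ρ, hρ⟩)
  · rw [not_imp_comm.1 (hc ρ) hρ, not_imp_comm.1 (hc' ρ) hρ]

/-- Points have unique coefficients with respect to the fan. -/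
theorem IsFineStar.coeff_unique (hK : IsFineStar K) {c c' : Ray → ℝ} (h0 : ∀ ρ, 0 ≤ c ρ)
    (h0' : ∀ ρ, 0 ≤ c' ρ) (hc : Together K (Function.support c))
    (hc' : Together K (Function.support c')) (h : combo c = combo c') : c = c' := by
  obtain ⟨s, hs, hs0, hsc⟩ := hK.exists_together_facet hc
  obtain ⟨s', hs', hs0', hsc'⟩ := hK.exists_together_facet hc'
  -- Scaling by `r` makes both coefficient sums at most 1, so the common point lies in both
  -- simplices, the origin absorbing the remainder. It is then a combination `w` of common vertices,
  -- and linear independence in each simplex identifies `w` with both scaled vectors.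
  let r := (1 + ∑ ρ, c ρ + ∑ ρ, c' ρ)⁻¹
  have hS : 0 ≤ ∑ ρ, c ρ := Finset.sum_nonneg fun ρ _ => h0 ρ
  have hS' : 0 ≤ ∑ ρ, c' ρ := Finset.sum_nonneg fun ρ _ => h0' ρ
  have hr : 0 < r := by positivity
  have hmem {s : Finset E} {c : Ray → ℝ} (hs : s ∈ K.faces) (hz : (0 : E) ∈ s)
      (h0 : ∀ ρ, 0 ≤ c ρ) (hsc : ∀ ρ ∈ Function.support c, pt ρ ∈ s)
      (hsum : r * ∑ ρ, c ρ ≤ 1) : r • combo c ∈ convexHull ℝ (s : Set E) := by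
    rw [mem_convexHull_iff (hK.face_subset hs)]
    refine ⟨r • c, fun ρ => mul_nonneg hr.le (h0 ρ), fun ρ hρ => hsc ρ ?_, ?_, fun _ => hz,
      combo_smul r c⟩
    · exact fun h => hρ (by simp [h])
    · simpa [← Finset.mul_sum] using hsum
  have h1 : r * ∑ ρ, c ρ ≤ 1 := by
    rw [inv_mul_le_one₀ (by positivity)]
    linarith
  have h1' : r * ∑ ρ, c' ρ ≤ 1 := by
    rw [inv_mul_le_one₀ (by positivity)]
    linarith
  have hinter := K.inter_subset_convexHull hs.1 hs'.1
    ⟨hmem hs.1 hs0 h0 hsc h1, h ▸ hmem hs'.1 hs0' h0' hsc' h1'⟩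
  rw [mem_convexHull_iff (inter_subset_left.trans (hK.face_subset hs.1))] at hinter
  obtain ⟨w, -, hw, -, -, hwc⟩ := hinter
  have e1 : w = r • c := coeff_unique_of_linearIndependent
    (linearIndependent_of_face hs.1 hs0) (fun ρ hρ => (hw ρ hρ).1)
    (fun ρ hρ => hsc ρ fun h => hρ (by simp [h])) (by rw [hwc, combo_smul])
  have e2 : w = r • c' := coeff_unique_of_linearIndependent
    (linearIndependent_of_face hs'.1 hs0') (fun ρ hρ => (hw ρ hρ).2)
    (fun ρ hρ => hsc' ρ fun h => hρ (by simp [h])) (by rw [hwc, combo_smul, h])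
  exact smul_right_injective _ hr.ne' (e1.symm.trans e2)

theorem exists_nonneg_combo (y : E) : ∃ c : Ray → ℝ, (∀ ρ, 0 ≤ c ρ) ∧ combo c = y := by
  obtain ⟨m, s, hm, -, hy⟩ := exists_coordinates y
  refine ⟨coeffs m 0 (max s 0) (max (-s) 0), ?_, hy _ (mult_coeffs _ _ _ _) ?_⟩
  · rw [Ray.forall_iff]
    simp only [coeffs_lo, coeffs_hi]
    exact ⟨fun x => by simpa using hm x, fun x => le_rfl, le_max_right _ _, le_max_right _ _⟩
  · rw [height_coeffs]
    rcases le_total s 0 with h | h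
    · rw [max_eq_right h, max_eq_left (by linarith)]
      simp
    · rw [max_eq_left h, max_eq_right (by linarith)]
      simp

/-- The fan of a fine star triangulation is complete. -/
theorem IsFineStar.exists_coeff (hK : IsFineStar K) (y : E) :
    ∃ c : Ray → ℝ, (∀ ρ, 0 ≤ c ρ) ∧ Together K (Function.support c) ∧ combo c = y := by
  obtain ⟨c, hc, rfl⟩ := exists_nonneg_combo y
  let r := 1 + ∑ ρ, c ρ
  have hS : 0 ≤ ∑ ρ, c ρ := Finset.sum_nonneg fun ρ _ => hc ρ
  have hr : 0 < r := by positivity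
  have hmem : r⁻¹ • combo c ∈ K.space := by
    rw [hK.space_eq]
    refine convexHull_min points_subset_polytope (convex_convexHull ℝ _) ?_
    rw [mem_convexHull_iff subset_rfl]
    refine ⟨r⁻¹ • c, fun ρ => mul_nonneg (inv_nonneg.2 hr.le) (hc ρ), fun ρ _ => Or.inr ⟨ρ, rfl⟩,
      ?_, fun _ => Or.inl rfl, combo_smul _ _⟩
    simp only [Pi.smul_apply, smul_eq_mul, ← Finset.mul_sum]
    rw [inv_mul_le_one₀ hr]
    linarith
  obtain ⟨s, hs, hmem⟩ := Geometry.SimplicialComplex.mem_space_iff.1 hmem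
  obtain ⟨c', h0, hsupp, -, -, h⟩ := (mem_convexHull_iff (hK.face_subset hs)).1 hmem
  refine ⟨r • c', fun ρ => mul_nonneg hr.le (h0 ρ), ⟨s, hs, fun ρ hρ => hsupp ρ fun h => hρ ?_⟩, ?_⟩
  · simp [h]
  · rw [combo_smul, h, smul_inv_smul₀ hr.ne']

/-! ### The tournament of a fine star triangulation -/

theorem pt_lo_add (x : Line) : pt (lo x) + pt e = pt (hi x) := by
  have key : ∀ x k, nu (lo x) k + nu e k = nu (hi x) k := by decide
  ext k
  simp only [pt, Pi.add_apply]
  exact_mod_cast key x k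

theorem pt_hi_add (x : Line) : pt (hi x) + pt f = pt (lo x) := by
  have key : ∀ x k, nu (hi x) k + nu f k = nu (lo x) k := by decide
  ext k
  simp only [pt, Pi.add_apply]
  exact_mod_cast key x k

theorem pt_e_add_pt_f : pt e + pt f = 0 := by
  have key : ∀ k, nu e k + nu f k = 0 := by decide
  ext k
  simp only [pt, Pi.add_apply, Pi.zero_apply]
  exact_mod_cast key k

/-- One of the two lattice points on a line. -/
def pick (x : Line) (t : Bool) : Ray := if t then hi x else lo x

/-- The `a_i` sum to zero, so `n` is the number of upper points chosen. This is the relation which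
prevents a cone from meeting all three left lines. -/
theorem exists_sum_pick_inl (t : Fin 3 → Bool) :
    ∃ n : ℕ, ∑ i, pt (pick (inl i) (t i)) = (n : ℝ) • pt e := by
  have key : ∀ t : Fin 3 → Bool, ∃ n : Fin 4, ∀ k,
      ∑ i, nu (pick (inl i) (t i)) k = (n : ℕ) * nu e k := by decide
  obtain ⟨n, hn⟩ := key t
  refine ⟨n, ?_⟩
  ext k
  simp only [pt, Finset.sum_apply, Pi.smul_apply, smul_eq_mul]
  exact_mod_cast hn k

/-- The `c_l` sum to zero and `d_l = c_l + f`, so here `n` counts the lower points chosen. -/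
theorem exists_sum_pick_inr (t : Fin 3 → Bool) :
    ∃ n : ℕ, ∑ i, pt (pick (inr i) (t i)) = (n : ℝ) • pt f := by
  have key : ∀ t : Fin 3 → Bool, ∃ n : Fin 4, ∀ k,
      ∑ i, nu (pick (inr i) (t i)) k = (n : ℕ) * nu f k := by decide
  obtain ⟨n, hn⟩ := key t
  refine ⟨n, ?_⟩
  ext k
  simp only [pt, Finset.sum_apply, Pi.smul_apply, smul_eq_mul]
  exact_mod_cast hn k

theorem single_nonneg (ρ ρ' : Ray) : 0 ≤ (Pi.single ρ 1 : Ray → ℝ) ρ' := by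
  by_cases h : ρ' = ρ <;> simp [h]

theorem combo_sum {ι : Type*} (s : Finset ι) (c : ι → Ray → ℝ) :
    combo (∑ i ∈ s, c i) = ∑ i ∈ s, combo (c i) := by
  classical
  induction s using Finset.induction_on with
  | empty => simp [combo_zero]
  | insert i s hi ih => rw [Finset.sum_insert hi, Finset.sum_insert hi, combo_add, ih]

theorem combo_sum_single {ι : Type*} [Fintype ι] (r : ι → Ray) :
    combo (∑ i, Pi.single (r i) 1) = ∑ i, pt (r i) := by
  simp [combo_sum, combo_single]

/-- The relation `∑ r i = n ρ` is incompatible with a cone containing all `r i`. -/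
theorem IsFineStar.false_of_sum_eq (hK : IsFineStar K) {ι : Type*} [Fintype ι] (r : ι → Ray)
    (ρ : Ray) (n : ℝ) (hn : 0 ≤ n) (h : ∑ i, pt (r i) = n • pt ρ) (i : ι) (hi : r i ≠ ρ)
    (hr : Together K (range r)) : False := by
  have key := hK.coeff_unique (c := ∑ i, Pi.single (r i) 1) (c' := n • Pi.single ρ 1)
    (fun ρ' => ?_) (fun ρ' => mul_nonneg hn (single_nonneg ρ ρ')) (hr.mono ?_)
    ((hK.together_singleton ρ).mono ?_) (by rw [combo_sum_single, h, combo_smul, combo_single])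
  · have := congrFun key (r i)
    simp only [Finset.sum_apply, Pi.smul_apply, Pi.single_apply, hi, if_false, smul_zero] at this
    rw [Finset.sum_eq_zero_iff_of_nonneg (fun j _ => by split_ifs <;> simp)] at this
    simpa using this i (Finset.mem_univ i)
  · simp only [Finset.sum_apply]
    exact Finset.sum_nonneg fun i _ => single_nonneg _ _
  · intro ρ' h'
    rw [Function.mem_support, Finset.sum_apply] at h'
    obtain ⟨j, -, hj⟩ := Finset.exists_ne_zero_of_sum_ne_zero h'
    refine ⟨j, ?_⟩
    by_contra hne
    exact hj (by simp [Ne.symm hne])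
  · intro ρ' h'
    by_contra hne
    exact h' (by simp [show ρ' ≠ ρ from hne])

/-- Each clause excludes a relation that would contradict uniqueness of coefficients: `lo x + e = hi
x`, `hi x + f = lo x`, `e + f = 0`, and the sums over three lines of one kind. -/
theorem IsFineStar.thin (hK : IsFineStar K) {I : Set Ray} (h : Together K I) : Thin I where
  e_lo he x hx := by
    refine hK.false_of_sum_eq (![lo x, e]) (hi x) 1 zero_le_one (by simp [pt_lo_add]) 1
      (by cases x <;> simp [hi]) (h.mono ?_)
    rintro _ ⟨i, rfl⟩
    fin_cases i <;> assumption
  f_hi hf x hx := by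
    refine hK.false_of_sum_eq (![hi x, f]) (lo x) 1 zero_le_one (by simp [pt_hi_add]) 1
      (by cases x <;> simp [lo]) (h.mono ?_)
    rintro _ ⟨i, rfl⟩
    fin_cases i <;> assumption
  e_f he hf := by
    refine hK.false_of_sum_eq (![e, f]) e 0 le_rfl (by simp [pt_e_add_pt_f]) 1 (by simp)
      (h.mono ?_)
    rintro _ ⟨i, rfl⟩
    fin_cases i <;> assumption
  left := by
    classical
    by_contra! hne
    obtain ⟨n, hn⟩ := exists_sum_pick_inl fun i => decide (hi (inl i) ∈ I)
    refine hK.false_of_sum_eq (fun i => pick (inl i) (decide (hi (inl i) ∈ I))) e n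
      (Nat.cast_nonneg n) hn 0 ?_ (h.mono ?_)
    · unfold pick
      split_ifs <;> simp [lo, hi]
    · rintro _ ⟨i, rfl⟩
      by_cases hi' : hi (inl i) ∈ I
      · simp [pick, hi']
      · simpa [pick, hi'] using not_imp_comm.1 (hne i) hi'
  right := by
    classical
    by_contra! hne
    obtain ⟨n, hn⟩ := exists_sum_pick_inr fun i => decide (hi (inr i) ∈ I)
    refine hK.false_of_sum_eq (fun i => pick (inr i) (decide (hi (inr i) ∈ I))) f n
      (Nat.cast_nonneg n) hn 0 ?_ (h.mono ?_)
    · unfold pick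
      split_ifs <;> simp [lo, hi]
    · rintro _ ⟨i, rfl⟩
      by_cases hi' : hi (inr i) ∈ I
      · simp [pick, hi']
      · simpa [pick, hi'] using not_imp_comm.1 (hne i) hi'

theorem lo_ne_hi (x y : Line) : lo x ≠ hi y := by revert x y; decide

theorem lo_injective : Function.Injective lo := by decide

theorem hi_injective : Function.Injective hi := by decide

/-- The two pairs have the same sum, so they would give one vector two sets of coefficients. -/
theorem IsFineStar.not_both (hK : IsFineStar K) {x y : Line} (hxy : x ≠ y)
    (h : Together K {hi x, lo y}) : ¬ Together K {hi y, lo x} := by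
  intro h'
  have hsupp (x y) : Function.support (Pi.single (hi x) 1 + Pi.single (lo y) 1 : Ray → ℝ) ⊆
      {hi x, lo y} := by
    intro ρ hρ
    by_contra hne
    simp only [mem_insert_iff, mem_singleton_iff, not_or] at hne
    exact hρ (by simp [hne.1, hne.2])
  have h0 (x y ρ) : 0 ≤ (Pi.single (hi x) 1 + Pi.single (lo y) 1 : Ray → ℝ) ρ :=
    add_nonneg (single_nonneg _ _) (single_nonneg _ _)
  have key := hK.coeff_unique (h0 x y) (h0 y x) (h.mono (hsupp x y)) (h'.mono (hsupp y x)) (by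
    simp only [combo_add, combo_single, ← pt_lo_add]
    abel)
  have := congrFun key (hi x)
  simp [(lo_ne_hi _ _).symm, hi_injective.ne hxy] at this

/-- A probe of the triangulation: the cone containing the vector with multiplicities `m` and height
`s` cannot use `e` or `f`, because the height lies in the middle range. Its support then exhibits
edges of the triangulation. -/
theorem IsFineStar.exists_uppers (hK : IsFineStar K) {m : Line → ℝ} (hm : ∀ x, 0 ≤ m x)
    (hs : Sparse m) {s : ℝ} (h0 : 0 ≤ s) (h1 : s ≤ ∑ x, m x) :
    ∃ α : Line → ℝ, (∀ x, 0 ≤ α x ∧ α x ≤ m x) ∧ ∑ x, α x = s ∧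
      ∀ x y, α x ≠ 0 → α y ≠ m y → Together K {hi x, lo y} := by
  obtain ⟨y, hy⟩ : ∃ y, y = combo (coeffs m 0 s 0) := ⟨_, rfl⟩
  obtain ⟨c, hc, hT, hcy⟩ := hK.exists_coeff y
  have hthin := hK.thin hT
  have hc0 : ∀ ρ, 0 ≤ coeffs m 0 s 0 ρ := by
    rw [Ray.forall_iff]
    simp only [coeffs_lo, coeffs_hi]
    exact ⟨fun x => by simpa using hm x, fun x => le_rfl, h0, le_rfl⟩
  have hs' : Sparse (mult (coeffs m 0 s 0)) := by
    simpa only [Sparse, mult_coeffs] using hs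
  obtain ⟨hmul, hh⟩ := mult_eq_of_combo_eq hc hc0 hthin.sparse hs' (hcy.trans hy)
  simp only [mult_coeffs, height_coeffs, Pi.zero_apply, Finset.sum_const_zero, zero_add,
    sub_zero] at hmul hh
  obtain ⟨he, hf⟩ := hthin.coeff_eq hc
  simp only [hmul, hh] at he hf
  rw [max_eq_right (by linarith)] at he hf
  refine ⟨fun x => c (hi x), fun x => ⟨hc _, ?_⟩, ?_, fun x y hx hy => hT.mono ?_⟩
  · have := hmul x
    have := hc (lo x)
    simp only [mult] at *
    linarith
  · simpa [height, he, hf] using hh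
  · rintro ρ (rfl | rfl)
    · exact hx
    · intro h
      have := hmul y
      rw [mult, h, zero_add] at this
      exact hy this

theorem exists_ne_of_not_sameKind : ∀ x y z : Line, ¬ SameKind x y z →
    (∃ i, inl i ≠ x ∧ inl i ≠ y ∧ inl i ≠ z) ∧ ∃ l, inr l ≠ x ∧ inr l ≠ y ∧ inr l ≠ z := by
  unfold SameKind
  decide

theorem sparse_ite {q : Line → Prop} [DecidablePred q]
    (h : (∃ i, ¬ q (inl i)) ∧ ∃ l, ¬ q (inr l)) : Sparse fun w => if q w then 1 else 0 := by
  obtain ⟨⟨i, hi⟩, l, hl⟩ := h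
  exact ⟨⟨i, if_neg hi⟩, l, if_neg hl⟩

theorem IsFineStar.together_or (hK : IsFineStar K) {x y : Line} (hxy : x ≠ y) :
    Together K {hi x, lo y} ∨ Together K {hi y, lo x} := by
  have hex : ∀ x y : Line, (∃ i, ¬ (inl i = x ∨ inl i = y)) ∧ ∃ l, ¬ (inr l = x ∨ inr l = y) := by
    decide
  have hsum {g : Line → ℝ} (hg : ∀ w, w ≠ x → w ≠ y → g w = 0) : ∑ w, g w = g x + g y := by
    rw [← Finset.sum_pair hxy]
    refine (Finset.sum_subset (Finset.subset_univ _) fun w _ hw => ?_).symm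
    simp only [Finset.mem_insert, Finset.mem_singleton, not_or] at hw
    exact hg w hw.1 hw.2
  -- The probe is `hi x + lo y`: unit multiplicity on two lines, height 1.
  obtain ⟨α, hα, hs, hT⟩ := hK.exists_uppers (m := fun w => if w = x ∨ w = y then 1 else 0)
    (s := 1) (fun w => by split_ifs <;> norm_num) (sparse_ite (hex x y)) zero_le_one (by
      rw [hsum fun w h1 h2 => if_neg (by tauto)]
      simp)
  rw [hsum fun w h1 h2 => by simpa [h1, h2, ge_antisymm_iff] using hα w] at hs
  by_cases hx : α x = 0
  · refine Or.inr (hT y x ?_ ?_)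
    · intro h
      norm_num [hx, h] at hs
    · simp [hx]
  · by_cases hy : α y = 1
    · exact absurd (by linarith) hx
    · exact Or.inl (hT x y hx (by simpa using hy))

open Classical in
/-- The tournament of a triangulation. -/
noncomputable def datum (K : Geometry.SimplicialComplex ℝ E) : Datum :=
  (fun l i => decide (Together K {b i, d l}), fun i => decide (Together K {b i, a (i + 1)}),
    fun l => decide (Together K {c l, d (l + 1)}))

theorem IsFineStar.together_iff_not (hK : IsFineStar K) {x y : Line} (hxy : x ≠ y) :
    Together K {hi x, lo y} ↔ ¬ Together K {hi y, lo x} :=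
  ⟨hK.not_both hxy, (hK.together_or hxy).resolve_right⟩

theorem IsFineStar.ord_datum_iff (hK : IsFineStar K) {x y : Line} (hxy : x ≠ y) :
    Ord (datum K) x y ↔ Together K {hi x, lo y} := by
  have hfin : ∀ i j : Fin 3, i ≠ j → (j = i + 1 ∧ i ≠ j + 1) ∨ (i = j + 1 ∧ j ≠ i + 1) := by decide
  rcases x with i | l <;> rcases y with j | m
  · rcases hfin i j (by simpa using hxy) with ⟨rfl, h⟩ | ⟨rfl, h⟩
    · simp [Ord, datum, hi, lo]
      exact fun h' => absurd h' h
    · rw [hK.together_iff_not hxy]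
      simp [Ord, datum, hi, lo]
      exact fun h' => absurd h' h
  · simp [Ord, datum, hi, lo]
  · rw [hK.together_iff_not hxy]
    simp [Ord, datum, hi, lo]
  · rcases hfin l m (by simpa using hxy) with ⟨rfl, h⟩ | ⟨rfl, h⟩
    · simp [Ord, datum, hi, lo]
      exact fun h' => absurd h' h
    · rw [hK.together_iff_not hxy]
      simp [Ord, datum, hi, lo]
      exact fun h' => absurd h' h

/-- Probe a mixed cycle with unit multiplicities and height `3 / 2`. Whenever `u` precedes `v`,
either `α v = 0` or `α u = 1`; around a cycle this leaves only all zeros or all ones, with sums 0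
and 3. -/
theorem IsFineStar.good_datum (hK : IsFineStar K) : Good (datum K) := by
  intro x y z hk hxy hyz
  by_contra hxz'
  have hxz : x ≠ z := by
    rintro rfl
    exact hxy.asymm hyz
  have hzx := (Ord.total (datum K) hxz).resolve_left hxz'
  have hsum {g : Line → ℝ} (hg : ∀ w, w ≠ x → w ≠ y → w ≠ z → g w = 0) :
      ∑ w, g w = g x + g y + g z := by
    rw [← Finset.sum_subset (Finset.subset_univ {x, y, z}) fun w _ hw => ?_,
      Finset.sum_insert (by simp [hxy.ne, hxz]), Finset.sum_pair hyz.ne, add_assoc]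
    simp only [Finset.mem_insert, Finset.mem_singleton, not_or] at hw
    exact hg w hw.1 hw.2.1 hw.2.2
  obtain ⟨α, hα, hs, hT⟩ := hK.exists_uppers
    (m := fun w => if w = x ∨ w = y ∨ w = z then 1 else 0)
    (s := 3 / 2) (fun w => by split_ifs <;> norm_num)
    (sparse_ite (by simpa only [not_or] using exists_ne_of_not_sameKind x y z hk))
    (by norm_num) (by
      rw [hsum fun w h1 h2 h3 => if_neg (by tauto)]
      norm_num)
  rw [hsum fun w h1 h2 h3 => by simpa [h1, h2, h3, ge_antisymm_iff] using hα w] at hs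
  have key {u v : Line} (huv : Ord (datum K) u v) (hu : u = x ∨ u = y ∨ u = z) :
      α v = 0 ∨ α u = 1 := by
    by_contra! h
    have h1 := hT v u h.1 (by simpa [hu] using h.2)
    rw [← hK.ord_datum_iff huv.ne.symm] at h1
    exact huv.asymm h1
  have k1 := key hxy (by tauto)
  have k2 := key hyz (by tauto)
  have k3 := key hzx (by tauto)
  rcases k1 with k1 | k1 <;> rcases k2 with k2 | k2 <;> rcases k3 with k3 | k3 <;>
    norm_num [*] at hs <;> linarith

/-- The cones of a fine star triangulation are those of its tournament. -/
theorem IsFineStar.together_iff_cell (hK : IsFineStar K) (I : Set Ray) :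
    Together K I ↔ Cell (datum K) I := by
  have h1 {I : Set Ray} (h : Together K I) : Cell (datum K) I :=
    ⟨hK.thin h, fun x y hxy hx hy => (hK.ord_datum_iff hxy).2 (h.mono (by
      rintro ρ (rfl | rfl) <;> assumption))⟩
  refine ⟨h1, fun h => ?_⟩
  have hsupp : Function.support (indicator I 1 : Ray → ℝ) = I := by simp
  have hnonneg (ρ) : 0 ≤ (indicator I 1 : Ray → ℝ) ρ :=
    indicator_nonneg (fun _ _ => zero_le_one) ρ
  -- The sum of the rays in `I` lies in some cone of `K`, which is also a cell of the tournament.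
  -- Uniqueness among cells forces the coefficients to be those of the indicator, so `I` itself lies
  -- in that cone.
  obtain ⟨c, hc, hT, hcy⟩ := hK.exists_coeff (combo (indicator I 1))
  have := Cell.unique hc hnonneg (h1 hT) (by rwa [hsupp]) hcy
  rwa [this, hsupp] at hT

/-! ### The triangulation of a good tournament -/

theorem combo_extend {s : Set E} [DecidablePred (· ∈ s)] (g : {ρ // pt ρ ∈ s} → ℝ) :
    combo (fun ρ => if h : pt ρ ∈ s then g ⟨ρ, h⟩ else 0) = ∑ i, g i • pt i := by
  rw [combo, ← Fintype.sum_subtype_add_sum_subtype (fun ρ => pt ρ ∈ s),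
    Finset.sum_eq_zero (s := (Finset.univ : Finset {ρ // pt ρ ∉ s})), add_zero]
  · exact Finset.sum_congr rfl fun i _ => by simp [i.2]
  · rintro ⟨ρ, hρ⟩ -
    simp [hρ]

/-- The positive and negative parts of a linear relation are two nonnegative representations of one
vector within a cell, so they coincide and both vanish. -/
theorem Cell.linearIndependent {D : Datum} {s : Set E} (h : Cell D {ρ | pt ρ ∈ s}) :
    LinearIndependent ℝ (fun ρ : {ρ // pt ρ ∈ s} => pt ρ) := by
  classical
  rw [Fintype.linearIndependent_iff]
  intro g hg i
  have hsupp (g : {ρ // pt ρ ∈ s} → ℝ) :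
      Function.support (fun ρ => if h : pt ρ ∈ s then g ⟨ρ, h⟩ else 0) ⊆ {ρ | pt ρ ∈ s} := by
    intro ρ hρ
    by_contra hne
    exact hρ (dif_neg hne)
  have hnonneg (g : {ρ // pt ρ ∈ s} → ℝ) (hg : ∀ i, 0 ≤ g i) (ρ) :
      0 ≤ (fun ρ => if h : pt ρ ∈ s then g ⟨ρ, h⟩ else 0) ρ := by
    dsimp only
    split_ifs
    exacts [hg _, le_rfl]
  have key := Cell.unique (hnonneg (fun i => max (g i) 0) fun i => le_max_right _ _)
    (hnonneg (fun i => max (-g i) 0) fun i => le_max_right _ _) (h.mono (hsupp fun i => max (g i) 0))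
    (h.mono (hsupp fun i => max (-g i) 0)) (by
      refine (combo_extend fun i => max (g i) 0).trans
        (Eq.trans ?_ (combo_extend fun i => max (-g i) 0).symm)
      rw [← sub_eq_zero, ← Finset.sum_sub_distrib, ← hg]
      refine Finset.sum_congr rfl fun i _ => ?_
      rw [← sub_smul, max_zero_sub_max_neg_zero_eq_self])
  have hi := congrFun key i
  simp only [i.2, dif_pos] at hi
  rcases max_cases (g i) 0 with h | h <;> rcases max_cases (-g i) 0 with h' | h' <;> linarith

theorem affineIndependent_of_linearIndependent {s : Finset E} (hs : (s : Set E) ⊆ points)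
    (h : LinearIndependent ℝ (fun ρ : {ρ // pt ρ ∈ s} => pt ρ)) :
    AffineIndependent ℝ ((↑) : s → E) := by
  have h1 : LinearIndependent ℝ (fun x : range (fun ρ : {ρ // pt ρ ∈ s} => pt ρ) => (x : E)) :=
    h.linearIndepOn_id
  rw [linearIndependent_set_iff_affineIndependent_vadd_union_singleton ℝ (by
    rintro _ ⟨ρ, rfl⟩
    exact pt_ne_zero ρ) (0 : E)] at h1
  refine h1.mono fun x hx => ?_
  rcases hs hx with rfl | ⟨ρ, rfl⟩
  · exact Or.inl rfl
  · exact Or.inr ⟨pt ρ, ⟨⟨ρ, hx⟩, rfl⟩, by simp⟩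

/-- The simplicial complex of a tournament. -/
def cellComplex (D : Datum) : Geometry.SimplicialComplex ℝ E where
  faces := {s | s.Nonempty ∧ (s : Set E) ⊆ points ∧ Cell D {ρ | pt ρ ∈ s}}
  isRelLowerSet_faces := fun _ hs => ⟨hs.1, fun _ hts ht =>
    ⟨ht, (Finset.coe_subset.2 hts).trans hs.2.1, hs.2.2.mono fun _ hρ => hts hρ⟩⟩
  indep hs := affineIndependent_of_linearIndependent hs.2.1 hs.2.2.linearIndependent
  inter_subset_convexHull := by
    rintro s t hs ht y ⟨hys, hyt⟩
    obtain ⟨c, h0, hc, h1, hz, hy⟩ := (mem_convexHull_iff hs.2.1).1 hys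
    obtain ⟨c', h0', hc', h1', hz', hy'⟩ := (mem_convexHull_iff ht.2.1).1 hyt
    have key : c = c' := Cell.unique h0 h0' (hs.2.2.mono hc) (ht.2.2.mono hc') (hy.trans hy'.symm)
    subst key
    exact (mem_convexHull_iff (inter_subset_left.trans hs.2.1)).2
      ⟨c, h0, fun ρ hρ => ⟨hc ρ hρ, hc' ρ hρ⟩, h1, fun h => ⟨hz h, hz' h⟩, hy⟩

theorem cell_singleton (D : Datum) (ρ : Ray) : Cell D {ρ} := by
  refine ⟨⟨?_, ?_, ?_, ?_, ?_⟩, ?_⟩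
  · rintro rfl (x | x) h <;> cases h
  · rintro rfl (x | x) h <;> cases h
  · rintro rfl h
    cases h
  · revert ρ
    simp only [mem_singleton_iff]
    decide
  · revert ρ
    simp only [mem_singleton_iff]
    decide
  · rintro x y - rfl h
    exact absurd h (lo_ne_hi y x)

theorem Cell.insert_mem_faces {D : Datum} {I : Set Ray} (h : Cell D I) :
    ∃ s ∈ (cellComplex D).faces, (0 : E) ∈ s ∧ ∀ ρ, pt ρ ∈ s ↔ ρ ∈ I := by
  classical
  refine ⟨insert 0 ((toFinite I).toFinset.image pt), ⟨⟨0, by simp⟩, ?_, ?_⟩, by simp, ?_⟩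
  · intro x hx
    simp only [Finset.coe_insert, Finset.coe_image, Finite.coe_toFinset] at hx
    rcases hx with rfl | ⟨ρ, -, rfl⟩
    exacts [Or.inl rfl, Or.inr ⟨ρ, rfl⟩]
  · refine h.mono fun ρ hρ => ?_
    simpa [pt_ne_zero, pt_injective.eq_iff] using hρ
  · simp [pt_ne_zero, pt_injective.eq_iff]

theorem together_cellComplex (D : Datum) (I : Set Ray) :
    Together (cellComplex D) I ↔ Cell D I := by
  constructor
  · rintro ⟨s, hs, h⟩
    exact hs.2.2.mono h
  · intro h
    obtain ⟨s, hs, -, h⟩ := h.insert_mem_faces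
    exact ⟨s, hs, fun ρ => (h ρ).2⟩

theorem sum_eq_form_combo {m : Fin 5 → ℤ} {c : Ray → ℝ}
    (h : ∀ ρ, c ρ ≠ 0 → ∑ k, m k * nu ρ k = 1) : ∑ ρ, c ρ = form m (combo c) := by
  rw [form_combo]
  refine Finset.sum_congr rfl fun ρ _ => ?_
  by_cases hρ : c ρ = 0
  · simp [hρ]
  · rw [h ρ hρ, Int.cast_one, mul_one]

theorem Good.isFineStar {D : Datum} (hD : Good D) : IsFineStar (cellComplex D) where
  space_eq := by
    ext y
    rw [Geometry.SimplicialComplex.mem_space_iff]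
    constructor
    · rintro ⟨s, hs, hy⟩
      exact convexHull_min (hs.2.1.trans points_subset_polytope) (convex_convexHull ℝ _) hy
    · intro hy
      obtain ⟨c, h0, hc, rfl⟩ := hD.exists_cell y
      obtain ⟨s, hs, hs0, hsc⟩ := hc.insert_mem_faces
      refine ⟨s, hs, (mem_convexHull_iff hs.2.1).2
        ⟨c, h0, fun ρ => (hsc ρ).2, ?_, fun _ => hs0, rfl⟩⟩
      -- The coefficient sum equals a facet form at the point, hence is at most 1 in the polytope;
      -- the origin takes the rest.
      obtain ⟨j, hj⟩ := hc.1.exists_facetForm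
      rw [sum_eq_form_combo hj]
      exact facetForm_le_of_mem_polytope hy j
  vertices_eq := by
    rw [latticePoints_eq]
    ext x
    constructor
    · intro hx
      exact hx.2.1 (by simp)
    · intro hx
      refine ⟨Finset.singleton_nonempty x, by simpa using hx, ?_⟩
      rcases hx with rfl | ⟨ρ, rfl⟩
      · refine (cell_singleton D e).mono fun ρ hρ => ?_
        simp [pt_ne_zero] at hρ
      · refine (cell_singleton D ρ).mono fun ρ' hρ => ?_
        simpa [pt_injective.eq_iff] using hρ
  star := by
    classical
    intro s hs
    -- Cell conditions ignore the origin, so adjoining it to a face gives a face; maximality shows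
    -- it was already there.
    have h : insert (0 : E) s ∈ (cellComplex D).faces := by
      refine ⟨Finset.insert_nonempty _ _, ?_, hs.1.2.2.mono fun ρ hρ => ?_⟩
      · rw [Finset.coe_insert]
        exact insert_subset (Or.inl rfl) hs.1.2.1
      · simpa [pt_ne_zero] using hρ
    rw [hs.2 h (Finset.subset_insert _ _)]
    exact Finset.mem_insert_self _ _

theorem thin_lines (x y : Line) : Thin {lo x, hi x, lo y, hi y} := by
  refine ⟨?_, ?_, ?_, ?_, ?_⟩
  · cases x <;> cases y <;> simp [hi, lo]
  · cases x <;> cases y <;> simp [hi, lo]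
  · cases x <;> cases y <;> simp [hi, lo]
  · revert x y
    simp only [mem_insert_iff, mem_singleton_iff]
    decide
  · revert x y
    simp only [mem_insert_iff, mem_singleton_iff]
    decide

/-- On two lines with `x` before `y`, the only obstruction is the pair `{lo x, hi y}`. This yields
the edges and the triangles of the circuits. -/
theorem Ord.cell {D : Datum} {x y : Line} (h : Ord D x y) {I : Set Ray}
    (hI : I ⊆ {lo x, hi x, lo y, hi y}) (hne : lo x ∈ I → hi y ∉ I) : Cell D I := by
  refine ⟨(thin_lines x y).mono hI, fun z w hzw hz hw => ?_⟩
  have h1 : z = x ∨ z = y := by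
    simpa [(lo_ne_hi _ _).symm, hi_injective.eq_iff] using hI hz
  have h2 : w = x ∨ w = y := by
    simpa [lo_ne_hi, lo_injective.eq_iff] using hI hw
  rcases h1 with rfl | rfl <;> rcases h2 with rfl | rfl
  exacts [absurd rfl hzw, h, absurd hz (hne hw), absurd rfl hzw]

theorem cell_pair_iff (D : Datum) {x y : Line} (hxy : x ≠ y) :
    Cell D {hi x, lo y} ↔ Ord D x y := by
  refine ⟨fun h => h.2 x y hxy (by simp) (by simp), fun h => h.cell ?_ ?_⟩
  · rintro ρ (rfl | rfl) <;> simp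
  · simp [lo_ne_hi, lo_injective.eq_iff, hxy]

theorem datum_cellComplex (D : Datum) : datum (cellComplex D) = D := by
  have hne : ∀ i : Fin 3, i ≠ i + 1 ∧ i ≠ i + 1 + 1 := by decide
  refine Prod.ext (funext fun l => funext fun i => ?_)
    (Prod.ext (funext fun i => ?_) (funext fun l => ?_)) <;> rw [Bool.eq_iff_iff]
  · have := cell_pair_iff D (x := inl i) (y := inr l) (by simp)
    simpa [datum, together_cellComplex, hi, lo, Ord] using this
  · have := cell_pair_iff D (x := inl i) (y := inl (i + 1)) (by simp)
    simpa [datum, together_cellComplex, hi, lo, Ord, hne] using this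
  · have := cell_pair_iff D (x := inr l) (y := inr (l + 1)) (by simp)
    simpa [datum, together_cellComplex, hi, lo, Ord, hne] using this

/-- Fine star triangulations correspond to good tournaments. -/
theorem datum_bijOn : BijOn datum {K | IsFineStar K} {D | Good D} :=
  ⟨fun _ hK => IsFineStar.good_datum hK, fun _ hK _ hK' h =>
    IsFineStar.ext hK hK' fun I => by
      rw [IsFineStar.together_iff_cell hK, IsFineStar.together_iff_cell hK', h],
    fun D hD => ⟨cellComplex D, hD.isFineStar, datum_cellComplex D⟩⟩

theorem ncard_eq_of_datum {q : Geometry.SimplicialComplex ℝ E → Prop} {r : Datum → Prop}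
    (h : ∀ K, IsFineStar K → (q K ↔ r (datum K))) :
    {K | IsFineStar K ∧ q K}.ncard = {D | Good D ∧ r D}.ncard := by
  refine (BijOn.ncard_eq (f := datum) ?_)
  refine ⟨fun K hK => ⟨datum_bijOn.1 hK.1, (h K hK.1).1 hK.2⟩,
    datum_bijOn.2.1.mono fun K hK => hK.1, fun D hD => ?_⟩
  obtain ⟨K, hK, rfl⟩ := datum_bijOn.2.2 hD.1
  exact ⟨K, ⟨hK, (h K hK).2 hD.2⟩, rfl⟩

/-! ### Types and symmetry -/

theorem IsFineStar.circuitPos_iff (hK : IsFineStar K) (l i : Fin 3) :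
    CircuitPos K l i ↔ (datum K).1 l i = true := by
  simp only [CircuitPos, hK.together_iff_cell]
  constructor
  · exact fun h => h.1.2 (inl i) (inr l) (by simp) (by simp [hi]) (by simp [lo])
  · intro h
    have h' : Ord (datum K) (inl i) (inr l) := h
    refine ⟨h'.cell ?_ (by simp [hi, lo]), h'.cell ?_ (by simp [hi, lo])⟩ <;>
    · rintro ρ (rfl | rfl | rfl) <;> simp [hi, lo]

theorem IsFineStar.circuitNeg_iff (hK : IsFineStar K) (l i : Fin 3) :
    CircuitNeg K l i ↔ (datum K).1 l i = false := by
  simp only [CircuitNeg, hK.together_iff_cell]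
  constructor
  · exact fun h => h.1.2 (inr l) (inl i) (by simp) (by simp [hi]) (by simp [lo])
  · intro h
    have h' : Ord (datum K) (inr l) (inl i) := h
    refine ⟨h'.cell ?_ (by simp [hi, lo]), h'.cell ?_ (by simp [hi, lo])⟩ <;>
    · rintro ρ (rfl | rfl | rfl) <;> simp [hi, lo]

theorem IsFineStar.hasType_iff (hK : IsFineStar K) (σ : SignPattern) :
    HasType K σ ↔ (datum K).1 = σ := by
  simp only [HasType, hK.circuitPos_iff, hK.circuitNeg_iff]
  constructor
  · intro h
    funext l i
    obtain ⟨h1, h2⟩ := h l i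
    cases hσ : σ l i
    exacts [h2 hσ, h1 hσ]
  · rintro rfl l i
    exact ⟨id, id⟩

/-- The cyclic permutation of the lines. -/
def cycLine : Line → Line := Sum.map (· + 1) (· + 1)

theorem cyc_lo (x : Line) : cyc (lo x) = lo (cycLine x) := by cases x <;> rfl

theorem cyc_hi (x : Line) : cyc (hi x) = hi (cycLine x) := by cases x <;> rfl

theorem cyc_injective : Function.Injective cyc := by decide

theorem cycLine_injective : Function.Injective cycLine := by decide

theorem cycLine_surjective : Function.Surjective cycLine := by decide

theorem lo_mem_image_cyc {I : Set Ray} {x : Line} : lo (cycLine x) ∈ cyc '' I ↔ lo x ∈ I := by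
  rw [← cyc_lo, cyc_injective.mem_set_image]

theorem hi_mem_image_cyc {I : Set Ray} {x : Line} : hi (cycLine x) ∈ cyc '' I ↔ hi x ∈ I := by
  rw [← cyc_hi, cyc_injective.mem_set_image]

theorem Thin.image_cyc {I : Set Ray} (h : Thin I) : Thin (cyc '' I) := by
  have he : e ∈ cyc '' I ↔ e ∈ I := cyc_injective.mem_set_image (a := e)
  have hf : f ∈ cyc '' I ↔ f ∈ I := cyc_injective.mem_set_image (a := f)
  refine ⟨fun h1 x => ?_, fun h1 x => ?_, fun h1 => ?_, ?_, ?_⟩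
  · obtain ⟨x, rfl⟩ := cycLine_surjective x
    rw [lo_mem_image_cyc]
    exact h.e_lo (he.1 h1) x
  · obtain ⟨x, rfl⟩ := cycLine_surjective x
    rw [hi_mem_image_cyc]
    exact h.f_hi (hf.1 h1) x
  · rw [hf]
    exact h.e_f (he.1 h1)
  · obtain ⟨i, h1, h2⟩ := h.left
    exact ⟨i + 1, mt (lo_mem_image_cyc (x := inl i)).1 h1, mt (hi_mem_image_cyc (x := inl i)).1 h2⟩
  · obtain ⟨i, h1, h2⟩ := h.right
    exact ⟨i + 1, mt (lo_mem_image_cyc (x := inr i)).1 h1, mt (hi_mem_image_cyc (x := inr i)).1 h2⟩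

theorem Cell.image_cyc {D : Datum} {I : Set Ray} (h : Cell D I)
    (hord : ∀ x y, hi x ∈ I → lo y ∈ I → Ord D x y → Ord D (cycLine x) (cycLine y)) :
    Cell D (cyc '' I) := by
  refine ⟨h.1.image_cyc, fun x y hxy hx hy => ?_⟩
  obtain ⟨x, rfl⟩ := cycLine_surjective x
  obtain ⟨y, rfl⟩ := cycLine_surjective y
  rw [hi_mem_image_cyc] at hx
  rw [lo_mem_image_cyc] at hy
  exact hord x y hx hy (h.2 x y (fun h => hxy (by rw [h])) hx hy)

theorem IsFineStar.isSymmetric_iff_together (hK : IsFineStar K) :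
    IsSymmetric K ↔ ∀ I, Together K I → Together K (cyc '' I) := by
  classical
  constructor
  · rintro h I ⟨s, hs, hI⟩
    obtain ⟨t, ht, hst⟩ := h s hs
    refine ⟨t, ht, ?_⟩
    rintro _ ⟨ρ, hρ, rfl⟩
    rw [← Finset.mem_coe, hst, ← g2_pt]
    exact mem_image_of_mem _ (hI ρ hρ)
  · intro h s hs
    obtain ⟨hne, hsub, hT⟩ := hK.mem_faces_iff.1 hs
    refine ⟨s.image g2, hK.mem_faces_iff.2 ⟨hne.image _, ?_, (h _ hT).mono ?_⟩, by simp⟩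
    · rw [Finset.coe_image]
      rintro _ ⟨x, hx, rfl⟩
      rcases hsub hx with rfl | ⟨ρ, rfl⟩
      · exact Or.inl (map_zero g2)
      · exact Or.inr ⟨cyc ρ, (g2_pt ρ).symm⟩
    · intro ρ hρ
      obtain ⟨x, hx, hxρ⟩ := Finset.mem_image.1 (show pt ρ ∈ s.image g2 from hρ)
      rcases hsub hx with rfl | ⟨ρ', rfl⟩
      · exact absurd (hxρ.symm.trans (map_zero g2)) (pt_ne_zero ρ)
      · rw [g2_pt] at hxρ
        exact ⟨ρ', hx, pt_injective hxρ⟩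

/-- Orientations of the three pairs which are invariant under the cyclic permutation. -/
def Cyclic (p : Fin 3 → Bool) : Prop := ∀ i, p (i + 1) = p i

instance : DecidablePred Cyclic := fun p => inferInstanceAs (Decidable (∀ i, p (i + 1) = p i))

/-- Invariance of the cones amounts to invariance of the tournament under `cycLine`, since edges
detect the orientations and the remaining cell conditions are symmetric. -/
theorem IsFineStar.isSymmetric_iff (hK : IsFineStar K) :
    IsSymmetric K ↔ (∀ l i, (datum K).1 (l + 1) (i + 1) = (datum K).1 l i) ∧
      Cyclic (datum K).2.1 ∧ Cyclic (datum K).2.2 := by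
  have hfin : ∀ i : Fin 3, i ≠ i + 1 + 1 := by decide
  simp only [hK.isSymmetric_iff_together, hK.together_iff_cell]
  generalize datum K = D
  constructor
  · intro h
    have hord {x y : Line} (hxy : Ord D x y) : Ord D (cycLine x) (cycLine y) := by
      have := h _ ((cell_pair_iff D hxy.ne).2 hxy)
      rw [image_pair, cyc_hi, cyc_lo] at this
      exact (cell_pair_iff D (cycLine_injective.ne hxy.ne)).1 this
    refine ⟨fun l i => ?_, fun i => ?_, fun i => ?_⟩
    · cases hσ : D.1 l i
      · exact hord (x := inr l) (y := inl i) hσ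
      · exact hord (x := inl i) (y := inr l) hσ
    · cases hp : D.2.1 i
      · have := hord (x := inl (i + 1)) (y := inl i) (Or.inr ⟨rfl, hp⟩)
        simpa [Ord, cycLine, hfin] using this
      · have := hord (x := inl i) (y := inl (i + 1)) (Or.inl ⟨rfl, hp⟩)
        simpa [Ord, cycLine, hfin] using this
    · cases hp : D.2.2 i
      · have := hord (x := inr (i + 1)) (y := inr i) (Or.inr ⟨rfl, hp⟩)
        simpa [Ord, cycLine, hfin] using this
      · have := hord (x := inr i) (y := inr (i + 1)) (Or.inl ⟨rfl, hp⟩)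
        simpa [Ord, cycLine, hfin] using this
  · rintro ⟨hσ, hp, hq⟩ I hI
    unfold Cyclic at hp hq
    refine hI.image_cyc fun x y _ _ h => ?_
    rcases x with i | l <;> rcases y with j | m <;> simp only [Ord, cycLine, Sum.map_inl,
      Sum.map_inr, hσ, hp, hq, add_left_inj] at h ⊢ <;> exact h

/-! ### Coherence -/

/-- Heights on the rays inducing the orientations of all pairs of lines. -/
def HasHeights (K : Geometry.SimplicialComplex ℝ E) : Prop :=
  ∃ h : Ray → ℝ, ∀ x y, x ≠ y → Together K {hi x, lo y} → h (hi x) + h (lo y) < h (lo x) + h (hi y)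

/-- A necessary condition common to coherence and projectivity: on a facet containing `hi x` and `lo
y`, the piece `φ` respects the circuit relation, while `h` exceeds it at `lo x` or `hi y`, which
cannot both belong to the facet. -/
theorem IsFineStar.hasHeights_of_facets (hK : IsFineStar K) (h : Ray → ℝ)
    (H : ∀ s ∈ K.facets, ∃ φ : Ray → ℝ, (∀ x y, φ (hi x) + φ (lo y) = φ (lo x) + φ (hi y)) ∧
      (∀ ρ, pt ρ ∈ s → φ ρ = h ρ) ∧ ∀ ρ, pt ρ ∉ s → φ ρ < h ρ) : HasHeights K := by
  refine ⟨h, fun x y hxy hT => ?_⟩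
  obtain ⟨s, hs, -, hsT⟩ := hK.exists_together_facet hT
  obtain ⟨φ, hφ, h1, h2⟩ := H s hs
  rw [← h1 _ (hsT (hi x) (by simp)), ← h1 _ (hsT (lo y) (by simp)), hφ]
  have hle (ρ) : φ ρ ≤ h ρ := by
    by_cases hρ : pt ρ ∈ s
    exacts [(h1 ρ hρ).le, (h2 ρ hρ).le]
  by_cases hx : pt (lo x) ∈ s
  · have hy : pt (hi y) ∉ s := fun hy => hK.not_both hxy hT ⟨s, hs.1, by
      rintro ρ (rfl | rfl) <;> assumption⟩
    exact add_lt_add_of_le_of_lt (hle _) (h2 _ hy)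
  · exact add_lt_add_of_lt_of_le (h2 _ hx) (hle _)

theorem IsFineStar.hasHeights_of_isCoherent (hK : IsFineStar K) (h : IsCoherent K) :
    HasHeights K := by
  obtain ⟨h, hh⟩ := h
  refine hK.hasHeights_of_facets (fun ρ => h (pt ρ)) fun s hs => ?_
  obtain ⟨φ, h1, h2⟩ := hh s hs
  refine ⟨fun ρ => φ (pt ρ), fun x y => ?_, fun ρ hρ => h1 _ hρ, fun ρ hρ => h2 _ ?_ hρ⟩
  · have key (x) : φ (pt (hi x)) = φ.linear (pt e) + φ (pt (lo x)) := by
      rw [← pt_lo_add, add_comm, ← vadd_eq_add, φ.map_vadd, vadd_eq_add]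
    simp only [key]
    ring
  · rw [latticePoints_eq]
    exact Or.inr ⟨ρ, rfl⟩

/-- Uniqueness of coefficients makes a ray in a cone one of its generators. Strict convexity of a
support function thus gives a strict inequality at every ray outside the simplex. -/
theorem IsFineStar.mem_of_mem_span (hK : IsFineStar K) {s : Finset E} (hs : s ∈ K.faces) {ρ : Ray}
    (h : pt ρ ∈ Submodule.span NNReal (s : Set E)) : pt ρ ∈ s := by
  have key : ∀ y ∈ Submodule.span NNReal (s : Set E), ∃ c : Ray → ℝ, (∀ ρ, 0 ≤ c ρ) ∧
      (∀ ρ, c ρ ≠ 0 → pt ρ ∈ s) ∧ combo c = y := by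
    intro y hy
    induction hy using Submodule.span_induction with
    | mem x hx =>
      rcases hK.face_subset hs hx with rfl | ⟨ρ, rfl⟩
      · exact ⟨0, fun _ => le_rfl, by simp, combo_zero⟩
      · refine ⟨Pi.single ρ 1, single_nonneg ρ, fun ρ' h => ?_, combo_single ρ⟩
        by_cases h' : ρ' = ρ
        · rwa [h']
        · simp [h'] at h
    | zero => exact ⟨0, fun _ => le_rfl, by simp, combo_zero⟩
    | add x y _ _ hx hy =>
      obtain ⟨c, h0, h1, rfl⟩ := hx
      obtain ⟨c', h0', h1', rfl⟩ := hy
      refine ⟨c + c', fun ρ => add_nonneg (h0 ρ) (h0' ρ), fun ρ h => ?_, combo_add c c'⟩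
      by_cases hc : c ρ = 0
      · exact h1' ρ fun hc' => h (by simp [hc, hc'])
      · exact h1 ρ hc
    | smul r x _ hx =>
      obtain ⟨c, h0, h1, rfl⟩ := hx
      refine ⟨(r : ℝ) • c, fun ρ => mul_nonneg r.2 (h0 ρ), fun ρ h => h1 ρ fun hc => h ?_,
        combo_smul _ c⟩
      simp [hc]
  obtain ⟨c, h0, h1, h2⟩ := key _ h
  have := hK.coeff_unique h0 (single_nonneg ρ) ⟨s, hs, h1⟩ ((hK.together_singleton ρ).mono (by
    intro ρ' h'
    by_contra hne
    exact h' (by simp [show ρ' ≠ ρ from hne]))) (h2.trans (combo_single ρ).symm)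
  exact h1 ρ (by simp [this])

theorem IsFineStar.hasHeights_of_isProjectiveFan (hK : IsFineStar K) (h : IsProjectiveFan K) :
    HasHeights K := by
  obtain ⟨ψ, hψ⟩ := h
  refine hK.hasHeights_of_facets (fun ρ => ψ (pt ρ)) fun s hs => ?_
  obtain ⟨m, hm⟩ := hψ s hs
  refine ⟨fun ρ => m (pt ρ), fun x y => ?_, fun ρ hρ => ?_, fun ρ hρ => ?_⟩
  · simp only [← pt_lo_add, map_add]
    ring
  · exact (hm _).2.2 (Submodule.subset_span hρ)
  · exact lt_of_le_of_ne (hm _).1 fun h => hρ (hK.mem_of_mem_span hs.1 ((hm _).2.1 h))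

theorem Ord.exists_cycle_left {D : Datum} (h : Cyclic D.2.1) :
    ∃ x y z, Ord D x y ∧ Ord D y z ∧ Ord D z x := by
  have h1 : D.2.1 1 = D.2.1 0 := h 0
  have h2 : D.2.1 2 = D.2.1 1 := h 1
  cases h0 : D.2.1 0
  · exact ⟨inl 0, inl 2, inl 1, by simp [Ord, *], by simp [Ord, *], by simp [Ord, *]⟩
  · exact ⟨inl 0, inl 1, inl 2, by simp [Ord, *], by simp [Ord, *], by simp [Ord, *]⟩

theorem Ord.exists_cycle_right {D : Datum} (h : Cyclic D.2.2) :
    ∃ x y z, Ord D x y ∧ Ord D y z ∧ Ord D z x := by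
  have h1 : D.2.2 1 = D.2.2 0 := h 0
  have h2 : D.2.2 2 = D.2.2 1 := h 1
  cases h0 : D.2.2 0
  · exact ⟨inr 0, inr 2, inr 1, by simp [Ord, *], by simp [Ord, *], by simp [Ord, *]⟩
  · exact ⟨inr 0, inr 1, inr 2, by simp [Ord, *], by simp [Ord, *], by simp [Ord, *]⟩

/-- The difference `h (hi x) - h (lo x)` strictly increases along the tournament, which rules out
3-cycles. -/
theorem IsFineStar.not_cyclic_of_hasHeights (hK : IsFineStar K) (h : HasHeights K) :
    ¬ Cyclic (datum K).2.1 ∧ ¬ Cyclic (datum K).2.2 := by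
  obtain ⟨h, hh⟩ := h
  have key (H : ∃ x y z, Ord (datum K) x y ∧ Ord (datum K) y z ∧ Ord (datum K) z x) : False := by
    obtain ⟨x, y, z, h1, h2, h3⟩ := H
    have k1 := hh x y h1.ne ((hK.ord_datum_iff h1.ne).1 h1)
    have k2 := hh y z h2.ne ((hK.ord_datum_iff h2.ne).1 h2)
    have k3 := hh z x h3.ne ((hK.ord_datum_iff h3.ne).1 h3)
    linarith
  exact ⟨fun h => key (Ord.exists_cycle_left h), fun h => key (Ord.exists_cycle_right h)⟩

/-! ### Good tournaments as compatible row and column orientations -/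

/-- The orientation of a pair of lines of the same kind. -/
def Orient (p : Fin 3 → Bool) (i j : Fin 3) : Prop :=
  (j = i + 1 ∧ p i = true) ∨ (i = j + 1 ∧ p j = false)

instance (p : Fin 3 → Bool) (i j : Fin 3) : Decidable (Orient p i j) :=
  inferInstanceAs (Decidable ((j = i + 1 ∧ p i = true) ∨ (i = j + 1 ∧ p j = false)))

theorem Orient.trans_of_not_cyclic : ∀ p : Fin 3 → Bool, ¬ Cyclic p → ∀ i j k,
    Orient p i j → Orient p j k → Orient p i k := by decide

/-- Orientations of the pairs of columns compatible with the signs. -/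
def ColumnsCompatible (σ : Fin 3 → Fin 3 → Bool) (p : Fin 3 → Bool) : Prop :=
  ∀ l i, σ l i = σ l (i + 1) ∨ p i = σ l i

/-- Orientations of the pairs of rows compatible with the signs. -/
def RowsCompatible (σ : Fin 3 → Fin 3 → Bool) (q : Fin 3 → Bool) : Prop :=
  ∀ l i, σ l i = σ (l + 1) i ∨ q l = !σ l i

instance (σ : Fin 3 → Fin 3 → Bool) (p : Fin 3 → Bool) : Decidable (ColumnsCompatible σ p) :=
  inferInstanceAs (Decidable (∀ l i, σ l i = σ l (i + 1) ∨ p i = σ l i))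

instance (σ : Fin 3 → Fin 3 → Bool) (q : Fin 3 → Bool) : Decidable (RowsCompatible σ q) :=
  inferInstanceAs (Decidable (∀ l i, σ l i = σ (l + 1) i ∨ q l = !σ l i))

theorem eq_succ_or_eq_succ : ∀ i j : Fin 3, i ≠ j → (j = i + 1 ∧ i ≠ j + 1) ∨
    (i = j + 1 ∧ j ≠ i + 1) := by decide

/-- The entries say that column `j` precedes row `l`, which precedes column `i`; transitivity then
asks for `j` before `i`. -/
theorem columnsCompatible_iff (σ : Fin 3 → Fin 3 → Bool) (p : Fin 3 → Bool) :
    ColumnsCompatible σ p ↔ ∀ l j i, σ l j = true → σ l i = false → Orient p j i := by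
  constructor
  · intro h l j i hj hi
    have hij : j ≠ i := by
      rintro rfl
      simp [hi] at hj
    rcases eq_succ_or_eq_succ j i hij with ⟨rfl, -⟩ | ⟨rfl, -⟩
    · have := h l j
      simp_all [Orient]
    · have := h l i
      simp_all [Orient]
  · intro h l i
    have h1 := (eq_succ_or_eq_succ i (i + 1) (by simp)).elim And.right (fun h => absurd rfl h.2)
    cases hi : σ l i <;> cases hj : σ l (i + 1)
    · exact Or.inl rfl
    · simpa [Orient, h1] using h l (i + 1) i hj hi
    · simpa [Orient, h1] using h l i (i + 1) hi hj
    · exact Or.inl rfl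

/-- Exchanging the two kinds of lines transposes the array and reverses its signs. -/
theorem rowsCompatible_iff_columnsCompatible (σ : Fin 3 → Fin 3 → Bool) (q : Fin 3 → Bool) :
    RowsCompatible σ q ↔ ColumnsCompatible (fun i l => !σ l i) q := by
  simp only [RowsCompatible, ColumnsCompatible, Bool.not_inj_iff]
  exact forall_comm

theorem rowsCompatible_iff (σ : Fin 3 → Fin 3 → Bool) (q : Fin 3 → Bool) :
    RowsCompatible σ q ↔ ∀ i l m, σ l i = true → σ m i = false → Orient q m l := by
  rw [rowsCompatible_iff_columnsCompatible, columnsCompatible_iff]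
  simp only [Bool.not_eq_true', Bool.not_eq_false']
  exact forall_congr' fun i => ⟨fun h l m h1 h2 => h m l h2 h1, fun h l m h1 h2 => h m l h2 h1⟩

/-- A mixed triple has two lines of one kind and one of the other. By asymmetry all six patterns
reduce to the two in which the odd line is in the middle. -/
theorem good_iff (D : Datum) :
    Good D ↔ ColumnsCompatible D.1 D.2.1 ∧ RowsCompatible D.1 D.2.2 := by
  rw [columnsCompatible_iff, rowsCompatible_iff]
  constructor
  · intro h
    exact ⟨fun l j i h1 h2 => h (inl j) (inr l) (inl i) (by simp [SameKind]) h1 h2,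
      fun i l m h1 h2 => h (inr m) (inl i) (inr l) (by simp [SameKind]) h2 h1⟩
  · rintro ⟨h1, h2⟩ (i | l) (j | m) (k | n) hk hxy hyz
    · simp [SameKind] at hk
    · change D.1 n i = true
      by_contra h
      exact Ord.asymm (D := D) (x := inl i) (y := inl j) hxy (h1 n j i hyz (by simpa using h))
    · exact h1 m i k hxy hyz
    · change D.1 n i = true
      by_contra h
      exact Ord.asymm (D := D) (x := inr m) (y := inr n) hyz
        (h2 i m n hxy (by simpa using h))
    · change D.1 l k = false
      by_contra h
      exact Ord.asymm (D := D) (x := inl j) (y := inl k) hyz (h1 l k j (by simpa using h) hxy)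
    · exact h2 j n l hyz hxy
    · change D.1 l k = false
      by_contra h
      exact Ord.asymm (D := D) (x := inr l) (y := inr m) hxy
        (h2 k l m (by simpa using h) hyz)
    · simp [SameKind] at hk

theorem Good.trans {D : Datum} (h : Good D) (hp : ¬ Cyclic D.2.1) (hq : ¬ Cyclic D.2.2)
    {x y z : Line} (hxy : Ord D x y) (hyz : Ord D y z) : Ord D x z := by
  by_cases hk : SameKind x y z
  · rcases x with i | l <;> rcases y with j | m <;> rcases z with k | n <;> simp [SameKind] at hk
    · exact Orient.trans_of_not_cyclic _ hp i j k hxy hyz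
    · exact Orient.trans_of_not_cyclic _ hq l m n hxy hyz
  · exact h x y z hk hxy hyz

/-! ### Heights realizing transitive tournaments -/

theorem exists_rank {D : Datum} (h : ∀ x y z, Ord D x y → Ord D y z → Ord D x z) :
    ∃ u : Line → ℝ, (∀ x, 0 ≤ u x ∧ u x < 6) ∧ ∀ x y, Ord D x y → u x < u y := by
  classical
  refine ⟨fun x => (Finset.univ.filter fun y => Ord D y x).card, fun x => ⟨by positivity, ?_⟩,
    fun x y hxy => ?_⟩
  · have : (Finset.univ.filter fun y => Ord D y x).card < (Finset.univ : Finset Line).card :=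
      Finset.card_lt_card (Finset.filter_ssubset.2 ⟨x, Finset.mem_univ x, Ord.irrefl x⟩)
    simp only [Finset.card_univ, Fintype.card_sum, Fintype.card_fin] at this
    change ((Finset.univ.filter fun y => Ord D y x).card : ℝ) < 6
    exact_mod_cast this
  · refine Nat.cast_lt.2 (Finset.card_lt_card ⟨fun z hz => ?_, fun hsub => ?_⟩)
    · simp only [Finset.mem_filter, Finset.mem_univ, true_and] at hz ⊢
      exact h z x y hz hxy
    · have : x ∈ Finset.univ.filter fun z => Ord D z x := hsub (by simpa using hxy)
      exact Ord.irrefl x (by simpa using this)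

theorem formA_nu : ∀ k i, ∑ j, formA k j * nu (a i) j = if i = k then -2 else 1 := by decide

theorem formC_nu : ∀ k l, ∑ j, formC k j * nu (c l) j = if l = k then -2 else 1 := by decide

theorem formA_nu_eq_zero : ∀ k, (∀ l, ∑ j, formA k j * nu (c l) j = 0) ∧
    ∑ j, formA k j * nu e j = 0 := by decide

theorem formC_nu_eq_zero : ∀ k, (∀ i, ∑ j, formC k j * nu (a i) j = 0) ∧
    ∑ j, formC k j * nu e j = 0 := by decide

theorem formE_nu : (∀ i, ∑ j, formE j * nu (a i) j = 0) ∧ (∀ l, ∑ j, formE j * nu (c l) j = 0) ∧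
    ∑ j, formE j * nu e j = 1 := by decide

/-- The `a_i` with `i ≠ i₀`, the `c_l` with `l ≠ l₀` and `e` form a basis. The dual forms are
`(formA i₀ - formA i) / 3`, `(formC l₀ - formC l) / 3` and `formE`. -/
theorem exists_linearMap (i₀ l₀ : Fin 3) (v : Line → ℝ) (μ : ℝ) :
    ∃ m : E →ₗ[ℝ] ℝ, (∀ i ≠ i₀, m (pt (a i)) = v (inl i)) ∧
      (∀ l ≠ l₀, m (pt (c l)) = v (inr l)) ∧ m (pt e) = μ := by
  have key (w : Fin 3 → ℝ) (i₀ i : Fin 3) (hi : i ≠ i₀) :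
      ∑ j, w j / 3 * ((if i = i₀ then -2 else 1) - if i = j then -2 else 1) = w i := by
    rw [Finset.sum_eq_single i (fun j _ hj => by simp [hi, hj.symm]) (by simp)]
    simp only [hi, if_true, if_false]
    ring
  refine ⟨∑ i, (v (inl i) / 3) • (form (formA i₀) - form (formA i)) +
    ∑ l, (v (inr l) / 3) • (form (formC l₀) - form (formC l)) + μ • form formE, ?_, ?_, ?_⟩
  · intro i hi
    simpa [form_pt, formA_nu, formC_nu_eq_zero, formE_nu] using key (fun i => v (inl i)) i₀ i hi
  · intro l hl
    simpa [form_pt, formC_nu, formA_nu_eq_zero, formE_nu] using key (fun i => v (inr i)) l₀ l hl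
  · simp [form_pt, formC_nu_eq_zero, formA_nu_eq_zero, formE_nu]

/-- Heights inducing a coherent triangulation, for a given ranking of the lines. -/
def rankHeight (u : Line → ℝ) : Ray → ℝ
  | a _ => 100
  | b i => 100 + u (inl i)
  | c l => 100 + u (inr l)
  | d _ => 100
  | e => 6
  | f => 6

theorem rankHeight_lo (u : Line → ℝ) (x : Line) : rankHeight u (lo x) = 100 := by cases x <;> rfl

theorem rankHeight_hi (u : Line → ℝ) (x : Line) : rankHeight u (hi x) = 100 + u x := by
  cases x <;> rfl

theorem sum_pt_a : pt (a 0) + pt (a 1) + pt (a 2) = 0 := by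
  ext k
  fin_cases k <;> simp [pt, nu] <;> norm_num

theorem sum_pt_c : pt (c 0) + pt (c 1) + pt (c 2) = 0 := by
  ext k
  fin_cases k <;> simp [pt, nu]
  norm_num

/-- The supporting form of slope `μ` along `e`: on the four lines in use it lies below the lifted
points, touching `lo x` when `μ ≤ u x` and `hi x` when `u x ≤ μ`. On the two omitted lines the large
constant 100 pushes it strictly below. -/
theorem exists_supporting_map {u : Line → ℝ} (hu : ∀ x, 0 ≤ u x ∧ u x < 6) (i₀ l₀ : Fin 3) {μ : ℝ}
    (hμ : -6 ≤ μ) (hμ' : μ ≤ 6) : ∃ m : E →ₗ[ℝ] ℝ,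
      (∀ x, x ≠ inl i₀ → x ≠ inr l₀ → m (pt (lo x)) = 100 + min 0 (u x - μ) ∧
        m (pt (hi x)) = 100 + min μ (u x)) ∧
      (∀ x, x = inl i₀ ∨ x = inr l₀ → m (pt (lo x)) < 100 ∧ m (pt (hi x)) < 100) ∧
      m (pt e) = μ ∧ m (pt f) = -μ := by
  obtain ⟨m, h1, h2, h3⟩ := exists_linearMap i₀ l₀
    (Sum.elim (fun i => 100 + min 0 (u (inl i) - μ)) fun l => 100 + min μ (u (inr l))) μ
  have hhi (x) : m (pt (hi x)) = m (pt (lo x)) + μ := by rw [← pt_lo_add, map_add, h3]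
  have hc (l) : m (pt (d l)) = m (pt (c l)) - μ := eq_sub_of_add_eq (hhi (inr l)).symm
  have hb (i) : m (pt (b i)) = m (pt (a i)) + μ := hhi (inl i)
  have hadd (x) : min 0 (u x - μ) + μ = min μ (u x) := by
    rw [← min_add_add_right, zero_add, sub_add_cancel]
  have hmin (x) : -6 ≤ min μ (u x) := le_min hμ (by linarith [(hu x).1])
  have ha0 : m (pt (a 0)) + m (pt (a 1)) + m (pt (a 2)) = 0 := by
    rw [← map_add, ← map_add, sum_pt_a, map_zero]
  have hc0 : m (pt (c 0)) + m (pt (c 1)) + m (pt (c 2)) = 0 := by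
    rw [← map_add, ← map_add, sum_pt_c, map_zero]
  -- Here `88 = 100 - 6 - 6`. Values on three lines sum to zero, so the omitted one is at most `-2 *
  -- 88 = -176`.
  have ha1 (i) (hi : i ≠ i₀) : 88 ≤ m (pt (a i)) := by
    rw [h1 i hi, Sum.elim_inl]
    linarith [hadd (inl i), hmin (inl i)]
  have hc1 (l) (hl : l ≠ l₀) : 88 ≤ m (pt (c l)) := by
    rw [h2 l hl, Sum.elim_inr]
    linarith [hmin (inr l)]
  have ha2 : m (pt (a i₀)) ≤ -176 := by
    fin_cases i₀ <;> simp at ha1 ⊢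
    · linarith [ha1 1 (by decide), ha1 2 (by decide)]
    · linarith [ha1 0 (by decide), ha1 2 (by decide)]
    · linarith [ha1 0 (by decide), ha1 1 (by decide)]
  have hc2 : m (pt (c l₀)) ≤ -176 := by
    fin_cases l₀ <;> simp at hc1 ⊢
    · linarith [hc1 1 (by decide), hc1 2 (by decide)]
    · linarith [hc1 0 (by decide), hc1 2 (by decide)]
    · linarith [hc1 0 (by decide), hc1 1 (by decide)]
  refine ⟨m, ?_, ?_, h3, ?_⟩
  · rintro (i | l) hx hx'
    · have := h1 i (by simpa using hx)
      rw [Sum.elim_inl] at this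
      exact ⟨this, by rw [hhi, ← hadd]; simp only [lo]; linarith⟩
    · have := h2 l (by simpa using hx')
      rw [Sum.elim_inr] at this
      refine ⟨?_, this⟩
      simp only [lo]
      linarith [hc l, hadd (inr l)]
  · rintro x (rfl | rfl)
    · simp only [lo, hi, hb]
      constructor <;> linarith
    · simp only [lo, hi, hc]
      constructor <;> linarith
  · have := congrArg m pt_e_add_pt_f
    rw [map_add, map_zero] at this
    linarith

/-- A threshold between the ranks of the upper and the lower points of the cell; the extreme slopes
`6` and `-6` are reserved for `e` and `f`. -/
theorem Cell.exists_slope {D : Datum} {u : Line → ℝ} (hu : ∀ x, 0 ≤ u x ∧ u x < 6)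
    (hord : ∀ x y, Ord D x y → u x < u y) {I : Set Ray} (hI : Cell D I) :
    ∃ μ : ℝ, -6 ≤ μ ∧ μ ≤ 6 ∧ (∀ x, hi x ∈ I → u x ≤ μ) ∧ (∀ x, lo x ∈ I → μ ≤ u x) ∧
      (e ∈ I → μ = 6) ∧ (f ∈ I → μ = -6) := by
  classical
  by_cases he : e ∈ I
  · exact ⟨6, by norm_num, le_rfl, fun x _ => (hu x).2.le, fun x hx => absurd hx (hI.1.e_lo he x),
      fun _ => rfl, fun hf => absurd hf (hI.1.e_f he)⟩
  by_cases hex : ∃ x, hi x ∈ I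
  · obtain ⟨z, hz, hmax⟩ := Set.exists_max_image {x | hi x ∈ I} u (Set.toFinite _) hex
    refine ⟨u z, by linarith [(hu z).1], (hu z).2.le, hmax, fun x hx => ?_,
      fun h => absurd h he, fun hf => absurd hz (hI.1.f_hi hf z)⟩
    by_cases hxz : z = x
    · rw [hxz]
    · exact (hord z x (hI.2 z x hxz hz hx)).le
  · exact ⟨-6, le_rfl, by norm_num, fun x hx => absurd ⟨x, hx⟩ hex,
      fun x _ => by linarith [(hu x).1], fun h => absurd h he, fun _ => rfl⟩

/-- Converse to `Cell.exists_slope`: rays touched at a single slope form a cell, because a wrongly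
ordered pair would need two ranks on the wrong sides of `μ`. -/
theorem cell_of_slope {D : Datum} {u : Line → ℝ} (hu : ∀ x, 0 ≤ u x ∧ u x < 6)
    (hord : ∀ x y, Ord D x y → u x < u y) {J : Set Ray} {μ : ℝ} {i₀ l₀ : Fin 3}
    (hi₀ : lo (inl i₀) ∉ J ∧ hi (inl i₀) ∉ J) (hl₀ : lo (inr l₀) ∉ J ∧ hi (inr l₀) ∉ J)
    (h1 : ∀ x, hi x ∈ J → u x ≤ μ) (h2 : ∀ x, lo x ∈ J → μ ≤ u x) (he : e ∈ J → μ = 6)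
    (hf : f ∈ J → μ = -6) : Cell D J := by
  refine ⟨⟨fun h x hx => ?_, fun h x hx => ?_, fun h h' => ?_, ⟨i₀, hi₀⟩, l₀, hl₀⟩,
    fun x y hxy hx hy => (Ord.total D hxy).resolve_right fun hyx => ?_⟩
  · linarith [he h, h2 x hx, (hu x).2]
  · linarith [hf h, h1 x hx, (hu x).1]
  · linarith [he h, hf h']
  · linarith [hord y x hyx, h1 x hx, h2 y hy]

/-- For a facet, the form with a separating slope touches the lift at all its rays. The set of
touched rays is again a cell, so maximality makes it exactly the facet. -/
theorem IsFineStar.isCoherent_of_rank (hK : IsFineStar K) {u : Line → ℝ}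
    (hu : ∀ x, 0 ≤ u x ∧ u x < 6) (hord : ∀ x y, Ord (datum K) x y → u x < u y) :
    IsCoherent K := by
  classical
  -- The default value 0 is the height of the origin, as required by linear supporting forms.
  have hh0 : Function.extend pt (rankHeight u) 0 (0 : E) = 0 :=
    Function.extend_apply' _ _ _ (by
      rintro ⟨ρ, h⟩
      exact pt_ne_zero ρ h)
  refine ⟨Function.extend pt (rankHeight u) 0, fun s hs => ?_⟩
  have hI : Cell (datum K) {ρ | pt ρ ∈ s} :=
    (hK.together_iff_cell _).1 (hK.mem_faces_iff.1 hs.1).2.2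
  have h0 := hK.star s hs
  obtain ⟨μ, hμ, hμ', h1, h2, h3, h4⟩ := hI.exists_slope hu hord
  obtain ⟨i₀, hi₀⟩ := hI.1.left
  obtain ⟨l₀, hl₀⟩ := hI.1.right
  obtain ⟨m, m1, m2, m3, m4⟩ := exists_supporting_map hu i₀ l₀ hμ hμ'
  have hlo (x) : m (pt (lo x)) ≤ rankHeight u (lo x) := by
    rw [rankHeight_lo]
    by_cases hx : x = inl i₀ ∨ x = inr l₀
    · exact (m2 x hx).1.le
    · rw [not_or] at hx
      rw [(m1 x hx.1 hx.2).1]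
      linarith [min_le_left 0 (u x - μ)]
  have hhi (x) : m (pt (hi x)) ≤ rankHeight u (hi x) := by
    rw [rankHeight_hi]
    by_cases hx : x = inl i₀ ∨ x = inr l₀
    · linarith [(m2 x hx).2, (hu x).1]
    · rw [not_or] at hx
      rw [(m1 x hx.1 hx.2).2]
      linarith [min_le_right μ (u x)]
  have hle : ∀ ρ, m (pt ρ) ≤ rankHeight u ρ := by
    rw [Ray.forall_iff]
    exact ⟨hlo, hhi, m3.trans_le hμ', m4.trans_le (by simp only [rankHeight]; linarith)⟩
  have hmiss (x) (hx : x = inl i₀ ∨ x = inr l₀) :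
      lo x ∉ {ρ | m (pt ρ) = rankHeight u ρ} ∧ hi x ∉ {ρ | m (pt ρ) = rankHeight u ρ} := by
    simp only [mem_ofPred_eq, rankHeight_lo, rankHeight_hi]
    exact ⟨(m2 x hx).1.ne, by linarith [(m2 x hx).2, (hu x).1] |> ne_of_lt⟩
  have hJ : Cell (datum K) {ρ | m (pt ρ) = rankHeight u ρ} := by
    refine cell_of_slope hu hord (μ := μ) (hmiss _ (Or.inl rfl)) (hmiss _ (Or.inr rfl)) ?_ ?_ ?_ ?_
    · intro x hx
      have hx' : ¬ (x = inl i₀ ∨ x = inr l₀) := fun h => (hmiss x h).2 hx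
      rw [not_or] at hx'
      rw [mem_ofPred_eq, rankHeight_hi, (m1 x hx'.1 hx'.2).2] at hx
      exact min_eq_right_iff.1 (add_left_cancel hx)
    · intro x hx
      have hx' : ¬ (x = inl i₀ ∨ x = inr l₀) := fun h => (hmiss x h).1 hx
      rw [not_or] at hx'
      rw [mem_ofPred_eq, rankHeight_lo, (m1 x hx'.1 hx'.2).1] at hx
      have := min_eq_left_iff.1 (show min 0 (u x - μ) = 0 by linarith)
      linarith
    · intro h
      exact m3.symm.trans h
    · intro h
      have : m (pt f) = 6 := h
      linarith
  have hIJ : ∀ ρ, pt ρ ∈ s → m (pt ρ) = rankHeight u ρ := by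
    have hx' (x) (h : pt (lo x) ∈ s ∨ pt (hi x) ∈ s) : x ≠ inl i₀ ∧ x ≠ inr l₀ := by
      constructor <;> rintro rfl
      exacts [h.elim hi₀.1 hi₀.2, h.elim hl₀.1 hl₀.2]
    rw [Ray.forall_iff]
    refine ⟨fun x hx => ?_, fun x hx => ?_, fun h => m3.trans (h3 h),
      fun h => m4.trans (by rw [h4 h]; simp [rankHeight])⟩
    · obtain ⟨k1, k2⟩ := hx' x (Or.inl hx)
      rw [(m1 x k1 k2).1, rankHeight_lo, min_eq_left (by linarith [h2 x hx]), add_zero]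
    · obtain ⟨k1, k2⟩ := hx' x (Or.inr hx)
      rw [(m1 x k1 k2).2, rankHeight_hi, min_eq_right (h1 x hx)]
  obtain ⟨t, ht, ht0, htJ⟩ := hK.exists_together_facet ((hK.together_iff_cell _).2 hJ)
  have hst : s = t := hs.2 ht.1 fun x hx => by
    rcases hK.face_subset hs.1 hx with rfl | ⟨ρ, rfl⟩
    exacts [ht0, htJ ρ (hIJ ρ hx)]
  refine ⟨m.toAffineMap, fun x hx => ?_, fun p hp hps => ?_⟩
  · rcases hK.face_subset hs.1 hx with rfl | ⟨ρ, rfl⟩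
    · simp [hh0]
    · rw [pt_injective.extend_apply]
      exact hIJ ρ hx
  · rw [latticePoints_eq] at hp
    rcases hp with rfl | ⟨ρ, rfl⟩
    · exact absurd h0 hps
    · rw [pt_injective.extend_apply]
      refine lt_of_le_of_ne (hle ρ) fun h => hps ?_
      rw [hst]
      exact htJ ρ h

/-- A fine star triangulation is coherent if and only if its tournament is transitive. -/
theorem IsFineStar.isCoherent_iff (hK : IsFineStar K) :
    IsCoherent K ↔ ¬ Cyclic (datum K).2.1 ∧ ¬ Cyclic (datum K).2.2 := by
  refine ⟨fun h => hK.not_cyclic_of_hasHeights (hK.hasHeights_of_isCoherent h), fun h => ?_⟩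
  obtain ⟨u, hu, hord⟩ := exists_rank fun x y z => hK.good_datum.trans h.1 h.2
  exact hK.isCoherent_of_rank hu hord

/-! ### Counting -/

/-- The number of good tournaments with given signs and conditions on the pure pairs. -/
def count (A B : (Fin 3 → Bool) → Prop) [DecidablePred A] [DecidablePred B]
    (σ : Fin 3 → Fin 3 → Bool) : ℕ :=
  (Finset.univ.filter fun p => ColumnsCompatible σ p ∧ A p).card *
    (Finset.univ.filter fun q => RowsCompatible σ q ∧ B q).card

/-- For a fixed sign array, the orientations of left and of right pairs are chosen independently, so
each array contributes a product. -/
theorem ncard_good (S : (Fin 3 → Fin 3 → Bool) → Prop) (A B : (Fin 3 → Bool) → Prop)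
    [DecidablePred S] [DecidablePred A] [DecidablePred B] :
    {D : Datum | Good D ∧ S D.1 ∧ A D.2.1 ∧ B D.2.2}.ncard = ∑ σ with S σ, count A B σ := by
  have h : {D : Datum | Good D ∧ S D.1 ∧ A D.2.1 ∧ B D.2.2} =
      ((((Finset.univ.filter S).sigma fun σ =>
        (Finset.univ.filter fun p => ColumnsCompatible σ p ∧ A p) ×ˢ
          (Finset.univ.filter fun q => RowsCompatible σ q ∧ B q) :
            Finset (Σ _ : Fin 3 → Fin 3 → Bool, (Fin 3 → Bool) × (Fin 3 → Bool))).map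
        ⟨fun x => (x.1, x.2), fun x y h => by
          rcases x with ⟨x1, x2⟩
          rcases y with ⟨y1, y2⟩
          simpa using h⟩ : Finset Datum) : Set Datum) := by
    ext ⟨σ, p, q⟩
    simp only [Set.mem_ofPred_eq, good_iff, Finset.coe_map, Set.mem_image, Finset.mem_coe,
      Finset.mem_sigma, Finset.mem_filter, Finset.mem_univ, true_and, Finset.mem_product,
      Sigma.exists, Prod.exists]
    constructor
    · rintro ⟨⟨h1, h2⟩, hS, hA, hB⟩
      exact ⟨σ, p, q, ⟨hS, ⟨h1, hA⟩, h2, hB⟩, rfl⟩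
    · rintro ⟨σ', p', q', ⟨hS, ⟨h1, hA⟩, h2, hB⟩, h⟩
      have h' : (σ', p', q') = (σ, p, q) := h
      obtain ⟨rfl, rfl, rfl⟩ : σ' = σ ∧ p' = p ∧ q' = q := by simpa using h'
      exact ⟨⟨h1, h2⟩, hS, hA, hB⟩
  rw [h, Set.ncard_coe_finset, Finset.card_map, Finset.card_sigma]
  simp only [Finset.card_product, count]

/-- Whether `t` is compatible with two columns with the given entries. -/
def pairOk (x₀ y₀ x₁ y₁ x₂ y₂ t : Bool) : Bool :=
  (x₀ == y₀ || t == x₀) && ((x₁ == y₁ || t == x₁) && (x₂ == y₂ || t == x₂))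

/-- The number of `p` which satisfy three independent conditions. -/
def countAll (f g h : Bool → Bool) : ℕ :=
  ((f true).toNat + (f false).toNat) *
    (((g true).toNat + (g false).toNat) * ((h true).toNat + (h false).toNat))

/-- The number of constant `p` which satisfy three independent conditions. -/
def countCyclic (f g h : Bool → Bool) : ℕ :=
  (f true && (g true && h true)).toNat + (f false && (g false && h false)).toNat

theorem sum_fin_three {X : Type*} [Fintype X] (g : (Fin 3 → X) → ℕ) :
    ∑ s, g s = ∑ x, ∑ y, ∑ z, g ![x, y, z] := by
  let φ : X × X × X ≃ (Fin 3 → X) :=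
    { toFun := fun t => ![t.1, t.2.1, t.2.2]
      invFun := fun s => (s 0, s 1, s 2)
      left_inv := fun t => rfl
      right_inv := fun s => by
        ext i
        fin_cases i <;> rfl }
  classical
  rw [← φ.sum_comp, Fintype.sum_prod_type]
  exact Finset.sum_congr rfl fun x _ => Fintype.sum_prod_type _

theorem card_filter_fin_three (r : (Fin 3 → Bool) → Prop) [DecidablePred r] :
    (Finset.univ.filter r).card = ∑ x, ∑ y, ∑ z, if r ![x, y, z] then 1 else 0 := by
  rw [Finset.card_filter, sum_fin_three]

/-- Compatibility constrains the three pairs separately. Replacing each condition by its two Boolean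
values leaves a finite check over six bits. -/
theorem card_filter_pairs (f g h : Bool → Bool) :
    (Finset.univ.filter fun p : Fin 3 → Bool => f (p 0) ∧ g (p 1) ∧ h (p 2)).card =
      countAll f g h ∧
    (Finset.univ.filter fun p : Fin 3 → Bool =>
      (f (p 0) ∧ g (p 1) ∧ h (p 2)) ∧ Cyclic p).card = countCyclic f g h ∧
    (Finset.univ.filter fun p : Fin 3 → Bool =>
      (f (p 0) ∧ g (p 1) ∧ h (p 2)) ∧ ¬ Cyclic p).card =
        countAll f g h - countCyclic f g h := by
  have hc (x y z : Bool) : Cyclic ![x, y, z] ↔ x = y ∧ y = z := by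
    revert x y z
    decide
  have hf (f : Bool → Bool) : ∃ x y, f = fun t => bif t then x else y :=
    ⟨f true, f false, by
      ext t
      cases t <;> rfl⟩
  obtain ⟨x₁, x₂, rfl⟩ := hf f
  obtain ⟨y₁, y₂, rfl⟩ := hf g
  obtain ⟨z₁, z₂, rfl⟩ := hf h
  simp only [card_filter_fin_three, hc, Fintype.sum_bool, countAll, countCyclic]
  revert x₁ x₂ y₁ y₂ z₁ z₂
  decide +kernel

/-- A statistic of the columns of a sign type with the given entries. -/
def columns (F : (Bool → Bool) → (Bool → Bool) → (Bool → Bool) → ℕ)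
    (x₀ y₀ z₀ x₁ y₁ z₁ x₂ y₂ z₂ : Bool) : ℕ :=
  F (pairOk x₀ y₀ x₁ y₁ x₂ y₂) (pairOk y₀ z₀ y₁ z₁ y₂ z₂) (pairOk z₀ x₀ z₁ x₁ z₂ x₂)

/-- The product of a statistic of the columns with the dual statistic of the rows. -/
def fastCount (F : (Bool → Bool) → (Bool → Bool) → (Bool → Bool) → ℕ)
    (x₀ y₀ z₀ x₁ y₁ z₁ x₂ y₂ z₂ : Bool) : ℕ :=
  columns F x₀ y₀ z₀ x₁ y₁ z₁ x₂ y₂ z₂ *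
    columns F (!x₀) (!x₁) (!x₂) (!y₀) (!y₁) (!y₂) (!z₀) (!z₁) (!z₂)

theorem columnsCompatible_iff_pairOk (σ : Fin 3 → Fin 3 → Bool) (p : Fin 3 → Bool) :
    ColumnsCompatible σ p ↔
      pairOk (σ 0 0) (σ 0 1) (σ 1 0) (σ 1 1) (σ 2 0) (σ 2 1) (p 0) ∧
      pairOk (σ 0 1) (σ 0 2) (σ 1 1) (σ 1 2) (σ 2 1) (σ 2 2) (p 1) ∧
      pairOk (σ 0 2) (σ 0 0) (σ 1 2) (σ 1 0) (σ 2 2) (σ 2 0) (p 2) := by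
  simp only [pairOk, Bool.and_eq_true, Bool.or_eq_true, beq_iff_eq]
  constructor
  · intro h
    exact ⟨⟨h 0 0, h 1 0, h 2 0⟩, ⟨h 0 1, h 1 1, h 2 1⟩, h 0 2, h 1 2, h 2 2⟩
  · rintro ⟨⟨h1, h2, h3⟩, ⟨h4, h5, h6⟩, h7, h8, h9⟩ l i
    fin_cases l <;> fin_cases i <;> assumption

theorem count_eq (σ : Fin 3 → Fin 3 → Bool) :
    count (fun _ => True) (fun _ => True) σ = fastCount countAll (σ 0 0) (σ 0 1) (σ 0 2)
      (σ 1 0) (σ 1 1) (σ 1 2) (σ 2 0) (σ 2 1) (σ 2 2) ∧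
    count Cyclic Cyclic σ = fastCount countCyclic (σ 0 0) (σ 0 1) (σ 0 2)
      (σ 1 0) (σ 1 1) (σ 1 2) (σ 2 0) (σ 2 1) (σ 2 2) ∧
    count (fun p => ¬ Cyclic p) (fun q => ¬ Cyclic q) σ =
      fastCount (fun f g h => countAll f g h - countCyclic f g h) (σ 0 0) (σ 0 1) (σ 0 2)
        (σ 1 0) (σ 1 1) (σ 1 2) (σ 2 0) (σ 2 1) (σ 2 2) := by
  simp only [count, rowsCompatible_iff_columnsCompatible, columnsCompatible_iff_pairOk,
    (card_filter_pairs _ _ _).2, and_true, (card_filter_pairs _ _ _).1]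
  exact ⟨rfl, rfl, rfl⟩

theorem sum_signs (g : Bool → Bool → Bool → Bool → Bool → Bool → Bool → Bool → Bool → ℕ) :
    ∑ σ : Fin 3 → Fin 3 → Bool,
      g (σ 0 0) (σ 0 1) (σ 0 2) (σ 1 0) (σ 1 1) (σ 1 2) (σ 2 0) (σ 2 1) (σ 2 2) =
    ∑ x₀, ∑ y₀, ∑ z₀, ∑ x₁, ∑ y₁, ∑ z₁, ∑ x₂, ∑ y₂, ∑ z₂, g x₀ y₀ z₀ x₁ y₁ z₁ x₂ y₂ z₂ := by
  rw [sum_fin_three]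
  simp only [sum_fin_three (X := Bool)]
  rfl

theorem sum_count_all : ∑ σ, count (fun _ => True) (fun _ => True) σ = 824 := by
  simp only [count_eq]
  rw [sum_signs (fastCount countAll)]
  decide +kernel

theorem sum_count_not_cyclic :
    ∑ σ, count (fun p => ¬ Cyclic p) (fun q => ¬ Cyclic q) σ = 720 := by
  simp only [count_eq]
  rw [sum_signs (fastCount fun f g h => countAll f g h - countCyclic f g h)]
  decide +kernel

/-- Only the two constant arrays contribute: a nonconstant circulant array imposes opposite demands
on a pair of columns. Each constant array allows two cyclic orientations of either kind. -/
theorem sum_count_cyclic :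
    ∑ σ with (∀ l i : Fin 3, σ (l + 1) (i + 1) = σ l i), count Cyclic Cyclic σ = 8 := by
  have h (σ : Fin 3 → Fin 3 → Bool) : (∀ l i : Fin 3, σ (l + 1) (i + 1) = σ l i) ↔
      ((σ 1 1 == σ 0 0 && σ 2 2 == σ 0 0) && ((σ 1 2 == σ 0 1 && σ 2 0 == σ 0 1) &&
        (σ 1 0 == σ 0 2 && σ 2 1 == σ 0 2))) = true := by
    simp [Fin.forall_fin_succ]
    constructor
    · rintro ⟨⟨h1, h2, h3⟩, ⟨h4, h5, h6⟩, h7, h8, h9⟩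
      simp_all
    · rintro ⟨⟨h1, h2⟩, ⟨h3, h4⟩, h5, h6⟩
      simp_all
  simp only [Finset.sum_filter, count_eq, h]
  rw [sum_signs fun x₀ y₀ z₀ x₁ y₁ z₁ x₂ y₂ z₂ =>
    if ((y₁ == x₀ && z₂ == x₀) && ((z₁ == y₀ && x₂ == y₀) && (x₁ == z₀ && y₂ == z₀))) = true then
      fastCount countCyclic x₀ y₀ z₀ x₁ y₁ z₁ x₂ y₂ z₂ else 0]
  decide +kernel

/-! ### Orbits of sign types -/

/-- The permutations of `Fin 3`. -/
def perms : Fin 6 → Fin 3 → Fin 3 :=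
  ![![0, 1, 2], ![1, 2, 0], ![2, 0, 1], ![0, 2, 1], ![2, 1, 0], ![1, 0, 2]]

theorem exists_perms_eq : ∀ r : Equiv.Perm (Fin 3), ∃ k, ∀ i, r i = perms k i := by decide +kernel

theorem exists_eq_perms : ∀ k, ∃ r : Equiv.Perm (Fin 3), ∀ i, r i = perms k i := by decide +kernel

/-- The permutations of rows and columns and transposition, applied to a sign type. -/
def orbitMap (τ : Fin 3 → Fin 3 → Bool) (g : Fin 6 × Fin 6 × Bool) : Fin 3 → Fin 3 → Bool :=
  fun l i => bif g.2.2 then τ (perms g.1 l) (perms g.2.1 i) else τ (perms g.2.1 i) (perms g.1 l)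

theorem typeOrbit_eq (τ : SignPattern) : typeOrbit τ = Set.range (orbitMap τ) := by
  ext τ'
  constructor
  · rintro ⟨r, q, rfl | rfl⟩ <;> obtain ⟨k, hk⟩ := exists_perms_eq r <;>
      obtain ⟨k', hk'⟩ := exists_perms_eq q
    · exact ⟨(k, k', true), funext fun l => funext fun i => by
        simp only [orbitMap, ← hk, ← hk']
        rfl⟩
    · exact ⟨(k, k', false), funext fun l => funext fun i => by
        simp only [orbitMap, ← hk, ← hk']
        rfl⟩
  · rintro ⟨⟨k, k', t⟩, rfl⟩
    obtain ⟨r, hr⟩ := exists_eq_perms k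
    obtain ⟨q, hq⟩ := exists_eq_perms k'
    refine ⟨r, q, ?_⟩
    cases t
    · exact Or.inr (funext fun l => funext fun i => by
        simp only [orbitMap, ← hr, ← hq]
        rfl)
    · exact Or.inl (funext fun l => funext fun i => by
        simp only [orbitMap, ← hr, ← hq]
        rfl)

/-- Encoding of sign types by numbers. -/
def code (σ : Fin 3 → Fin 3 → Bool) : ℕ :=
  (σ 0 0).toNat + 2 * ((σ 0 1).toNat + 2 * ((σ 0 2).toNat + 2 * ((σ 1 0).toNat + 2 *
    ((σ 1 1).toNat + 2 * ((σ 1 2).toNat + 2 * ((σ 2 0).toNat + 2 * ((σ 2 1).toNat + 2 *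
      ((σ 2 2).toNat + 2 * 0))))))))

theorem toNat_add_two_mul_inj (x y : Bool) (m n : ℕ) :
    x.toNat + 2 * m = y.toNat + 2 * n ↔ x = y ∧ m = n := by
  cases x <;> cases y <;> simp <;> omega

theorem code_injective : Function.Injective code := by
  intro σ τ h
  simp only [code, toNat_add_two_mul_inj] at h
  obtain ⟨h0, h1, h2, h3, h4, h5, h6, h7, h8, -⟩ := h
  funext l i
  fin_cases l <;> fin_cases i <;> assumption

/-- A statistic of the entries of a sign type. -/
def onEntries (F : Bool → Bool → Bool → Bool → Bool → Bool → Bool → Bool → Bool → ℕ)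
    (σ : Fin 3 → Fin 3 → Bool) : ℕ :=
  F (σ 0 0) (σ 0 1) (σ 0 2) (σ 1 0) (σ 1 1) (σ 1 2) (σ 2 0) (σ 2 1) (σ 2 2)

/-- Evaluation at all 72 symmetries of each array; `t = true` covers the negated types, and
numerical codes make the orbit sizes cheap to compute. -/
theorem typeTable_spec : ∀ x ∈ typeTable, ∀ t : Bool,
    (Finset.univ.image fun g => code (orbitMap (fun l i => xor t (x.1 l i)) g)).card = x.2.1 ∧
    ∀ g, onEntries (fastCount countAll) (orbitMap (fun l i => xor t (x.1 l i)) g) = x.2.2.1 ∧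
      onEntries (fastCount fun f g h => countAll f g h - countCyclic f g h)
        (orbitMap (fun l i => xor t (x.1 l i)) g) = x.2.2.2 := by
  decide +kernel

/-! ### The intersection ring and the complete intersection -/

/-- A thin set misses some left line, and lines `i` and `j` are occupied. The lower point `a i`
excludes `e`, the upper point `b j` excludes `f`. -/
theorem Thin.third_left {I : Set Ray} (h : Thin I) {i j k : Fin 3} (hij : i ≠ j) (hki : k ≠ i)
    (hkj : k ≠ j) (hi' : a i ∈ I) (hj : b j ∈ I) : a k ∉ I ∧ b k ∉ I ∧ e ∉ I ∧ f ∉ I := by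
  obtain ⟨n, h1, h2⟩ := h.left
  have hn : n = k := by
    have h3 : n ≠ i := by
      rintro rfl
      exact h1 hi'
    have h4 : n ≠ j := by
      rintro rfl
      exact h2 hj
    clear * - hij hki hkj h3 h4
    omega
  subst hn
  exact ⟨h1, h2, fun he => h.e_lo he (inl i) hi', fun hf => h.f_hi hf (inl j) hj⟩

theorem Thin.third_right {I : Set Ray} (h : Thin I) {i j k : Fin 3} (hij : i ≠ j) (hki : k ≠ i)
    (hkj : k ≠ j) (hi' : c i ∈ I) (hj : d j ∈ I) : c k ∉ I ∧ d k ∉ I ∧ e ∉ I ∧ f ∉ I := by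
  obtain ⟨n, h1, h2⟩ := h.right
  have hn : n = k := by
    have h3 : n ≠ i := by
      rintro rfl
      exact h2 hi'
    have h4 : n ≠ j := by
      rintro rfl
      exact h1 hj
    clear * - hij hki hkj h3 h4
    omega
  subst hn
  exact ⟨h2, h1, fun he => h.e_lo he (inr j) hj, fun hf => h.f_hi hf (inr i) hi'⟩

theorem divisorClass_mul_eq_zero {ρ₁ ρ₂ ρ₃ : Ray} (h12 : ρ₁ ≠ ρ₂) (h13 : ρ₁ ≠ ρ₃) (h23 : ρ₂ ≠ ρ₃)
    (h : ¬ Together K {ρ₁, ρ₂, ρ₃}) :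
    divisorClass K ρ₁ * divisorClass K ρ₂ * divisorClass K ρ₃ = 0 := by
  simp only [divisorClass, ← map_mul]
  refine Ideal.Quotient.eq_zero_iff_mem.2 (Ideal.mem_sup_left (Ideal.subset_span
    ⟨{ρ₁, ρ₂, ρ₃}, by simpa using h, ?_⟩))
  rw [Finset.prod_insert (by simp [h12, h13]), Finset.prod_pair h23, mul_assoc]

theorem sum_form_mul_divisorClass (K : Geometry.SimplicialComplex ℝ E) (m : Fin 5 → ℤ) :
    ∑ ρ, ((∑ k, m k * nu ρ k : ℤ) : IntersectionRing K) * divisorClass K ρ = 0 := by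
  have h := Ideal.Quotient.eq_zero_iff_mem.2 (Ideal.mem_sup_right (S := stanleyReisner K)
    (Ideal.subset_span ⟨m, rfl⟩ : _ ∈ linearEquivalences))
  rw [map_sum] at h
  refine Eq.trans (Finset.sum_congr rfl fun ρ _ => ?_) h
  rw [map_mul, map_intCast (MvPolynomial.C : ℚ →+* MvPolynomial Ray ℚ), map_intCast]
  rfl

/-- The relation from `formA k` trades the divisors on the other two left lines for twice those on
line `k`. -/
theorem nefClass1_eq (K : Geometry.SimplicialComplex ℝ E) (k : Fin 3) :
    nefClass1 K = 3 * (divisorClass K (a k) + divisorClass K (b k)) + divisorClass K e := by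
  have h := sum_form_mul_divisorClass K (formA k)
  rw [Ray.sum_eq] at h
  fin_cases k <;>
  · simp [Fin.sum_univ_three, Fin.sum_univ_five, formA, nu] at h
    simp [nefClass1, Fin.sum_univ_three]
    linear_combination h

theorem nefClass2_eq (K : Geometry.SimplicialComplex ℝ E) (k : Fin 3) :
    nefClass2 K = 3 * (divisorClass K (c k) + divisorClass K (d k)) + divisorClass K f := by
  have h := sum_form_mul_divisorClass K (formC k)
  rw [Ray.sum_eq] at h
  fin_cases k <;>
  · simp [Fin.sum_univ_three, Fin.sum_univ_five, formC, nu] at h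
    simp [nefClass2, Fin.sum_univ_three]
    linear_combination h

theorem exists_third : ∀ i j : Fin 3, ∃ k, k ≠ i ∧ k ≠ j := by decide

/-- With `k` the third index, every divisor in the representative `3 (D_{a_k} + D_{b_k}) + D_e`
gives a Stanley-Reisner monomial with `a i` and `b j`. -/
theorem IsFineStar.divisorClass_mul_nefClass1 (hK : IsFineStar K) {i j : Fin 3} (hij : i ≠ j) :
    divisorClass K (a i) * divisorClass K (b j) * nefClass1 K = 0 := by
  obtain ⟨k, hki, hkj⟩ := exists_third i j
  have key {ρ : Ray} (hρ : ρ = a k ∨ ρ = b k ∨ ρ = e) :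
      divisorClass K (a i) * divisorClass K (b j) * divisorClass K ρ = 0 := by
    refine divisorClass_mul_eq_zero (by simp) ?_ ?_ fun h => ?_
    · rcases hρ with rfl | rfl | rfl <;> simp [hki.symm]
    · rcases hρ with rfl | rfl | rfl <;> simp [hkj.symm]
    · have := (hK.thin h).third_left hij hki hkj (by simp) (by simp)
      rcases hρ with rfl | rfl | rfl <;> simp at this
  rw [nefClass1_eq K k]
  linear_combination 3 * key (Or.inl rfl) + 3 * key (Or.inr (Or.inl rfl)) +
    key (Or.inr (Or.inr rfl))

theorem IsFineStar.divisorClass_mul_nefClass2 (hK : IsFineStar K) {i j : Fin 3} (hij : i ≠ j) :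
    divisorClass K (c i) * divisorClass K (d j) * nefClass2 K = 0 := by
  obtain ⟨k, hki, hkj⟩ := exists_third i j
  have key {ρ : Ray} (hρ : ρ = c k ∨ ρ = d k ∨ ρ = f) :
      divisorClass K (c i) * divisorClass K (d j) * divisorClass K ρ = 0 := by
    refine divisorClass_mul_eq_zero (by simp) ?_ ?_ fun h => ?_
    · rcases hρ with rfl | rfl | rfl <;> simp [hki.symm]
    · rcases hρ with rfl | rfl | rfl <;> simp [hkj.symm]
    · have := (hK.thin h).third_right hij hki hkj (by simp) (by simp)
      rcases hρ with rfl | rfl | rfl <;> simp at this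
  rw [nefClass2_eq K k]
  linear_combination 3 * key (Or.inl rfl) + 3 * key (Or.inr (Or.inl rfl)) +
    key (Or.inr (Or.inr rfl))

/-! ### Intersections with the complete intersection -/

theorem coeff_eq_zero_iff_of_toPoint_eq {z w : coxDomain K} (h : toPoint K z = toPoint K w)
    (ρ : Ray) : z.1 ρ = 0 ↔ w.1 ρ = 0 := by
  obtain ⟨t, -, ht⟩ := Quotient.exact h
  rw [ht ρ]
  simp

/-- The factor `z_{a_1} z_{a_2} z_{a_3}` removes the second part of `F1`, and only the summand of
the third index survives, all of whose coordinates are nonzero. -/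
theorem IsFineStar.not_F1_eq_zero (hK : IsFineStar K) {z : Ray → ℂ} (hz : z ∈ coxDomain K)
    {α : Fin 3 → ℂ} (hα : ∀ m, α m ≠ 0) (α' α'' : ℂ) {i j : Fin 3} (hij : i ≠ j)
    (hi : z (a i) = 0) (hj : z (b j) = 0) : F1 α α' α'' z ≠ 0 := by
  obtain ⟨k, hki, hkj⟩ := exists_third i j
  obtain ⟨h1, h2, h3, -⟩ := (hK.thin hz).third_left hij hki hkj hi hj
  have hprod : z (a 0) * z (a 1) * z (a 2) = 0 := by
    fin_cases i <;> simp at hi <;> simp [hi]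
  rw [F1, hprod, mul_zero, add_zero, Finset.sum_eq_single k]
  · exact mul_ne_zero (mul_ne_zero (mul_ne_zero (hα k) (pow_ne_zero 3 h1)) (pow_ne_zero 3 h2)) h3
  · intro m _ hm
    have : m = i ∨ m = j := by omega
    rcases this with rfl | rfl
    · simp [hi]
    · simp [hj]
  · simp

theorem IsFineStar.not_F2_eq_zero (hK : IsFineStar K) {z : Ray → ℂ} (hz : z ∈ coxDomain K)
    {β : Fin 3 → ℂ} (hβ : ∀ m, β m ≠ 0) (β' β'' : ℂ) {i j : Fin 3} (hij : i ≠ j)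
    (hi : z (c i) = 0) (hj : z (d j) = 0) : F2 β β' β'' z ≠ 0 := by
  obtain ⟨k, hki, hkj⟩ := exists_third i j
  obtain ⟨h1, h2, -, h3⟩ := (hK.thin hz).third_right hij hki hkj hi hj
  have hprod : z (c 0) * z (c 1) * z (c 2) = 0 := by
    fin_cases i <;> simp at hi <;> simp [hi]
  rw [F2, hprod, mul_zero, add_zero, Finset.sum_eq_single k]
  · exact mul_ne_zero (mul_ne_zero (mul_ne_zero (hβ k) (pow_ne_zero 3 h1)) (pow_ne_zero 3 h2)) h3
  · intro m _ hm
    have : m = i ∨ m = j := by omega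
    rcases this with rfl | rfl
    · simp [hi]
    · simp [hj]
  · simp

theorem IsFineStar.inter_Xbar_eq_empty (hK : IsFineStar K) {i j : Fin 3} (hij : i ≠ j)
    {α : Fin 3 → ℂ} (α' α'' : ℂ) {β : Fin 3 → ℂ} (β' β'' : ℂ) (hα : ∀ m, α m ≠ 0)
    (hβ : ∀ m, β m ≠ 0) :
    toricDivisor K (a i) ∩ toricDivisor K (b j) ∩ Xbar K α α' α'' β β' β'' = ∅ ∧
    toricDivisor K (c i) ∩ toricDivisor K (d j) ∩ Xbar K α α' α'' β β' β'' = ∅ := by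
  constructor <;> rw [Set.eq_empty_iff_forall_notMem] <;>
    rintro x ⟨⟨⟨z₁, rfl, h1⟩, z₂, hz₂, h2⟩, z, hz, hF1, hF2⟩
  · exact hK.not_F1_eq_zero z.2 hα α' α'' hij ((coeff_eq_zero_iff_of_toPoint_eq hz _).2 h1)
      ((coeff_eq_zero_iff_of_toPoint_eq (hz.trans hz₂.symm) _).2 h2) hF1
  · exact hK.not_F2_eq_zero z.2 hβ β' β'' hij ((coeff_eq_zero_iff_of_toPoint_eq hz _).2 h1)
      ((coeff_eq_zero_iff_of_toPoint_eq (hz.trans hz₂.symm) _).2 h2) hF2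

/-! ### The cyclic permutation of the homogeneous coordinates -/

theorem cyc_cyc_cyc (ρ : Ray) : cyc (cyc (cyc ρ)) = ρ := by revert ρ; decide

/-- The cyclic permutation of the homogeneous coordinates. -/
def shift {R : Type*} (z : Ray → R) : Ray → R := fun ρ => z (cyc (cyc ρ))

theorem shift_cyc {R : Type*} (z : Ray → R) (ρ : Ray) : shift z (cyc ρ) = z ρ := by
  rw [shift, cyc_cyc_cyc]

theorem shift_shift_shift {R : Type*} (z : Ray → R) : shift (shift (shift z)) = z := by
  ext ρ
  simp [shift, cyc_cyc_cyc]

/-- The lattice automorphism `g2Matrix` permutes the rays, so the character of `m` on the shifted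
element is that of `m` composed with the matrix. -/
theorem shift_mem_coxGroup {t : Ray → ℂˣ} (ht : t ∈ coxGroup) : shift t ∈ coxGroup := by
  intro m
  have h := ht fun j => ∑ k, m k * g2Matrix k j
  have hbij : Function.Bijective cyc := Finite.injective_iff_bijective.1 cyc_injective
  rw [← h, ← hbij.prod_comp]
  refine Finset.prod_congr rfl fun ρ _ => ?_
  rw [shift_cyc]
  congr 1
  simp only [← g2Matrix_nu, Finset.mul_sum, Finset.sum_mul]
  rw [Finset.sum_comm]
  exact Finset.sum_congr rfl fun _ _ => Finset.sum_congr rfl fun _ _ => (mul_assoc _ _ _).symm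

theorem F1_shift (α α' α'' : ℂ) (z : Ray → ℂ) :
    F1 (fun _ => α) α' α'' (shift z) = F1 (fun _ => α) α' α'' z := by
  simp [F1, shift, cyc, Fin.sum_univ_three]
  ring

theorem F2_shift (β β' β'' : ℂ) (z : Ray → ℂ) :
    F2 (fun _ => β) β' β'' (shift z) = F2 (fun _ => β) β' β'' z := by
  simp [F2, shift, cyc, Fin.sum_univ_three]
  ring

/-- The cyclic permutation can break a cell only at a pure pair `{hi x, lo y}`, since constant signs
preserve mixed pairs. The hypotheses on the zeros of `z` exclude these pure pairs. -/
theorem IsFineStar.shift_mem_coxDomain (hK : IsFineStar K) {s : Bool}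
    (hs : (datum K).1 = fun _ _ => s) {z : Ray → ℂ} (hz : z ∈ coxDomain K)
    (h1 : ∀ i j, i ≠ j → z (a i) = 0 → z (b j) ≠ 0) (h2 : ∀ i j, i ≠ j → z (c i) = 0 → z (d j) ≠ 0) :
    shift z ∈ coxDomain K := by
  have hcell := (hK.together_iff_cell _).1 hz
  have hset : {ρ | shift z ρ = 0} = cyc '' {ρ | z ρ = 0} := by
    ext ρ
    constructor
    · exact fun h => ⟨cyc (cyc ρ), h, cyc_cyc_cyc ρ⟩
    · rintro ⟨ρ, h, rfl⟩
      exact (shift_cyc z ρ).trans h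
  change Together K {ρ | shift z ρ = 0}
  rw [hset, hK.together_iff_cell]
  refine hcell.image_cyc fun x y hx hy hxy => ?_
  rcases x with i | l <;> rcases y with j | m
  · exact absurd hx (h1 j i (fun h => hxy.ne (by rw [h])) hy)
  · simpa [Ord, cycLine, hs] using hxy
  · simpa [Ord, cycLine, hs] using hxy
  · exact absurd hy (h2 l m (fun h => hxy.ne (by rw [h])) hx)

theorem toPoint_shift {z w : coxDomain K} (h : toPoint K z = toPoint K w)
    (hz : shift z.1 ∈ coxDomain K) (hw : shift w.1 ∈ coxDomain K) :
    toPoint K ⟨shift z.1, hz⟩ = toPoint K ⟨shift w.1, hw⟩ := by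
  obtain ⟨t, ht, hzw⟩ := Quotient.exact h
  exact Quotient.sound ⟨shift t, shift_mem_coxGroup ht, fun ρ => hzw _⟩

/-- If the mixed circuits all have the same sign, symmetric complete intersections in the toric
variety are symmetric, although the toric variety need not be. -/
theorem IsFineStar.isG2Symmetric (hK : IsFineStar K) {s : Bool} (hs : (datum K).1 = fun _ _ => s)
    {a₁ a₂ a₃ a₄ a₅ a₆ : ℂ} (h1 : a₁ ≠ 0) (h4 : a₄ ≠ 0) :
    IsG2Symmetric K (Xbar K (fun _ => a₁) a₂ a₃ (fun _ => a₄) a₅ a₆) := by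
  set X := Xbar K (fun _ => a₁) a₂ a₃ (fun _ => a₄) a₅ a₆ with hX
  have hdom (x : X) (z : coxDomain K) (hz : toPoint K z = x.1) : shift z.1 ∈ coxDomain K := by
    obtain ⟨_, w, rfl, hF1, hF2⟩ := x
    refine hK.shift_mem_coxDomain hs z.2 (fun i j hij hi hj => ?_) fun i j hij hi hj => ?_
    · exact hK.not_F1_eq_zero w.2 (fun _ => h1) a₂ a₃ hij
        ((coeff_eq_zero_iff_of_toPoint_eq hz _).1 hi)
        ((coeff_eq_zero_iff_of_toPoint_eq hz _).1 hj) hF1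
    · exact hK.not_F2_eq_zero w.2 (fun _ => h4) a₅ a₆ hij
        ((coeff_eq_zero_iff_of_toPoint_eq hz _).1 hi)
        ((coeff_eq_zero_iff_of_toPoint_eq hz _).1 hj) hF2
  -- The image point does not depend on the representative, because shifting preserves the group.
  have hex (x : X) : ∃ y : X, ∀ (z : coxDomain K) (hz : toPoint K z = x.1),
      toPoint K ⟨shift z.1, hdom x z hz⟩ = y.1 := by
    obtain ⟨w, hw, hF1, hF2⟩ := x.2
    refine ⟨⟨toPoint K ⟨shift w.1, hdom x w hw⟩, _, rfl, ?_, ?_⟩, fun z hz =>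
      toPoint_shift (hz.trans hw.symm) _ _⟩
    · exact (F1_shift _ _ _ _).trans hF1
    · exact (F2_shift _ _ _ _).trans hF2
  choose g hg using hex
  have hg3 (x : X) : g (g (g x)) = x := by
    obtain ⟨z, hz, -⟩ := x.2
    have k1 := hg x z hz
    have k2 := hg (g x) _ k1
    have k3 := hg (g (g x)) _ k2
    refine Subtype.ext (k3.symm.trans (Eq.trans ?_ hz))
    congr 1
    exact Subtype.ext (shift_shift_shift z.1)
  refine ⟨⟨g, fun x => g (g x), hg3, hg3⟩, Equiv.ext fun x => ?_, fun x z hz =>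
    ⟨⟨shift z.1, hdom x z hz⟩, shift_cyc z.1, hg x z hz⟩⟩
  simpa [pow_succ] using hg3 x

/-! ### The numbers of triangulations -/

theorem ncard_isFineStar : {K | IsFineStar K}.ncard = 824 := by
  have h := ncard_eq_of_datum (q := fun _ => True) (r := fun _ => True ∧ True ∧ True) fun K hK => by
    simp
  simp only [and_true] at h
  rw [h, ← sum_count_all]
  simpa using ncard_good (fun _ => True) (fun _ => True) fun _ => True

theorem ncard_isCoherent : {K | IsFineStar K ∧ IsCoherent K}.ncard = 720 := by
  rw [ncard_eq_of_datum (r := fun D => True ∧ ¬ Cyclic D.2.1 ∧ ¬ Cyclic D.2.2) fun K hK => by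
      rw [hK.isCoherent_iff, true_and],
    ncard_good (fun _ => True) (fun p => ¬ Cyclic p) (fun q => ¬ Cyclic q), ← sum_count_not_cyclic]
  simp

theorem ncard_isSymmetric : {K | IsFineStar K ∧ IsSymmetric K}.ncard = 8 := by
  rw [ncard_eq_of_datum (r := fun D => (∀ l i, D.1 (l + 1) (i + 1) = D.1 l i) ∧
    Cyclic D.2.1 ∧ Cyclic D.2.2) fun K hK => hK.isSymmetric_iff, ← sum_count_cyclic]
  exact ncard_good (fun σ => ∀ l i, σ (l + 1) (i + 1) = σ l i) Cyclic Cyclic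

theorem ncard_good_eq (τ : Fin 3 → Fin 3 → Bool) (A B : (Fin 3 → Bool) → Prop)
    [DecidablePred A] [DecidablePred B] :
    {D : Datum | Good D ∧ D.1 = τ ∧ A D.2.1 ∧ B D.2.2}.ncard = count A B τ := by
  rw [ncard_good (fun σ => σ = τ) A B, Finset.filter_eq', if_pos (Finset.mem_univ _),
    Finset.sum_singleton]

theorem ncard_hasType (τ : SignPattern) :
    {K | IsFineStar K ∧ HasType K τ}.ncard = onEntries (fastCount countAll) τ := by
  rw [ncard_eq_of_datum (r := fun D => D.1 = τ ∧ True ∧ True) fun K hK =>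
      (hK.hasType_iff τ).trans (by simp only [and_true]),
    ncard_good_eq τ (fun _ => True) (fun _ => True)]
  exact (count_eq τ).1

theorem ncard_isCoherent_hasType (τ : SignPattern) :
    {K | IsFineStar K ∧ IsCoherent K ∧ HasType K τ}.ncard =
      onEntries (fastCount fun f g h => countAll f g h - countCyclic f g h) τ := by
  rw [ncard_eq_of_datum (r := fun D => D.1 = τ ∧ ¬ Cyclic D.2.1 ∧ ¬ Cyclic D.2.2) fun K hK =>
      (and_congr hK.isCoherent_iff (hK.hasType_iff τ)).trans and_comm,
    ncard_good_eq τ (fun p => ¬ Cyclic p) (fun q => ¬ Cyclic q)]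
  exact (count_eq τ).2.2

theorem typeOrbit_spec {σ τ : SignPattern} {μ n k : ℕ} (h : (σ, μ, n, k) ∈ typeTable) (t : Bool)
    (hτ : τ = fun l i => xor t (σ l i)) :
    (typeOrbit τ).ncard = μ ∧
    ∀ τ' ∈ typeOrbit τ,
      {K | IsFineStar K ∧ HasType K τ'}.ncard = n ∧
      {K | IsFineStar K ∧ IsCoherent K ∧ HasType K τ'}.ncard = k := by
  obtain ⟨h1, h2⟩ := typeTable_spec _ h t
  rw [typeOrbit_eq τ]
  subst hτ
  constructor
  · refine Eq.trans ?_ h1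
    rw [← Set.ncard_coe_finset, Finset.coe_image, Finset.coe_univ, Set.image_univ]
    exact (Set.ncard_image_of_injective _ code_injective).symm.trans
      (congrArg Set.ncard (Set.range_comp _ _).symm)
  · rintro _ ⟨g, rfl⟩
    exact ⟨(ncard_hasType _).trans (h2 g).1, (ncard_isCoherent_hasType _).trans (h2 g).2⟩

theorem mem_typeTable_const :
    ((fun _ _ => true, 1, 2 ^ 6, 36) : SignPattern × ℕ × ℕ × ℕ) ∈ typeTable := by
  have h : (!![true, true, true; true, true, true; true, true, true] : SignPattern) =
      fun _ _ => true := by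
    ext l i
    fin_cases l <;> fin_cases i <;> rfl
  rw [← h]
  exact List.mem_cons_self

theorem ncard_tClass (s : Bool) : (TClass s).ncard = 36 :=
  -- The table lists the all-plus array, so the sign flip needed to reach the constant `s` is `!s`.
  ((typeOrbit_spec (τ := fun _ _ => s) mem_typeTable_const (!s) (by cases s <;> rfl)).2 (fun _ _ => s)
    ⟨1, 1, Or.inl rfl⟩).2

end NablaBar

theorem mainTheorem5 :
    {K | NablaBar.IsFineStar K}.ncard = 824 ∧
    {K | NablaBar.IsFineStar K ∧ NablaBar.IsCoherent K}.ncard = 720 ∧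
    (∀ σ μ n k, (σ, μ, n, k) ∈ NablaBar.typeTable →
      ∀ τ, τ = σ ∨ τ = σ.map Bool.not →
        (NablaBar.typeOrbit τ).ncard = μ ∧
        ∀ τ' ∈ NablaBar.typeOrbit τ,
          {K | NablaBar.IsFineStar K ∧ NablaBar.HasType K τ'}.ncard = n ∧
          {K | NablaBar.IsFineStar K ∧ NablaBar.IsCoherent K ∧
            NablaBar.HasType K τ'}.ncard = k) ∧
    {K | NablaBar.IsFineStar K ∧ NablaBar.IsSymmetric K}.ncard = 8 ∧
    (∀ K, NablaBar.IsFineStar K → NablaBar.IsSymmetric K →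
      ¬ NablaBar.IsCoherent K ∧ ¬ NablaBar.IsProjectiveFan K) ∧
    (∀ K, NablaBar.IsFineStar K → ∀ i j : Fin 3, i ≠ j →
      (NablaBar.divisorClass K (.a i) * NablaBar.divisorClass K (.b j) *
          NablaBar.nefClass1 K = 0 ∧
        NablaBar.divisorClass K (.c i) * NablaBar.divisorClass K (.d j) *
          NablaBar.nefClass2 K = 0) ∧
      ∀ (α : Fin 3 → ℂ) (α' α'' : ℂ) (β : Fin 3 → ℂ) (β' β'' : ℂ),
        (∀ m, α m ≠ 0) → (∀ m, β m ≠ 0) →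
        NablaBar.toricDivisor K (.a i) ∩ NablaBar.toricDivisor K (.b j) ∩
            NablaBar.Xbar K α α' α'' β β' β'' = ∅ ∧
        NablaBar.toricDivisor K (.c i) ∩ NablaBar.toricDivisor K (.d j) ∩
            NablaBar.Xbar K α α' α'' β β' β'' = ∅) ∧
    (∀ sgn : Bool, (NablaBar.TClass sgn).ncard = 36 ∧
      ∀ K ∈ NablaBar.TClass sgn, ∀ a₁ a₂ a₃ a₄ a₅ a₆ : ℂ, a₁ ≠ 0 → a₄ ≠ 0 →
        NablaBar.IsG2Symmetric K
          (NablaBar.Xbar K (fun _ => a₁) a₂ a₃ (fun _ => a₄) a₅ a₆)) := by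
  refine ⟨NablaBar.ncard_isFineStar, NablaBar.ncard_isCoherent, ?_, NablaBar.ncard_isSymmetric,
    ?_, ?_, ?_⟩
  · rintro σ μ n k h τ (rfl | rfl)
    · exact NablaBar.typeOrbit_spec h false (by simp only [Bool.false_xor])
    · exact NablaBar.typeOrbit_spec h true (by simp only [Bool.true_xor]; rfl)
  · intro K hK hs
    -- Invariance orients the three left lines cyclically, and this one cycle obstructs both
    -- coherence and projectivity.
    have hp := (hK.isSymmetric_iff.1 hs).2.1
    exact ⟨fun h => (hK.isCoherent_iff.1 h).1 hp, fun h =>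
      (hK.not_cyclic_of_hasHeights (hK.hasHeights_of_isProjectiveFan h)).1 hp⟩
  · intro K hK i j hij
    exact ⟨⟨hK.divisorClass_mul_nefClass1 hij, hK.divisorClass_mul_nefClass2 hij⟩,
      fun α α' α'' β β' β'' hα hβ => hK.inter_Xbar_eq_empty hij α' α'' β' β'' hα hβ⟩
  · intro s
    refine ⟨NablaBar.ncard_tClass s, ?_⟩
    rintro K ⟨hK, -, hs⟩ a₁ a₂ a₃ a₄ a₅ a₆ h1 h4
    exact hK.isG2Symmetric ((hK.hasType_iff _).1 hs) h1 h4
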